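/- All Banach spaces are over one fixed field $\mathbb K\in\{\mathbb R,\mathbb C\}$, and $L(X,Y)$ denotes the bounded linear operators. For Banach spaces $E,F$: An *extension* is a short exact sequence $0\to E\xrightarrow{i}G\xrightarrow{\sigma}F\to 0$ with $G$ a Banach space, $i\in L(E,G)$, $\sigma\in L(G,F)$. Two extensions $(G_1,i_1,\sigma_1)$, $(G_2,i_2,\sigma_2)$ are *congruent* if there is a linear homeomorphism $h:G_1\to G_2$ with $hi_1=i_2$ and $\sigma_2h=\sigma_1$. $\mathrm{Ext}^1(F,E)$ is the set of congruence classes. $R(F,E)$ is the space of continuous maps $h:F\to E$ with $h(\lambda x)=\lambda h(x)$ for all scalars $\lambda$ and $\|h(x)\|\le C\|x\|$ for some $C$, with norm $\sup_{x\ne0}\|h(x)\|/\|x\|$. $S(F,E)$ is the space of *factor systems*: continuous maps $\phi:F\times F\to E$ such that $\phi(\lambda x,\lambda y)=\lambda\phi(x,y)$, $\phi(x,y)=\phi(y,x)$, $\phi(x,0)=0$, $\phi(x,y)+\phi(x+y,z)=\phi(y,z)+\phi(x,y+z)$, and, for some $C\ge 0$ and all $n\ge1$, $x_1,\dots,x_n\in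 F$, $$\Big\|\sum_{k=1}^{n-1}\phi\Big(\sum_{i=1}^kx_i,\,x_{k+1}\Big)\Big\|\le C\sum_{i=1}^n\|x_i\| ;$$ its norm is the infimum of such $C$. The operator $\rho:R(F,E)\to S(F,E)$ is $\rho h(x,y)=h(x+y)-h(x)-h(y)$. For $T\in L(E,E')$ the *pushout* $T\alpha\in \mathrm{Ext}^1(F,E')$ of the class $\alpha$ of $(G,i,\sigma)$ has middle space $(G\oplus E')/\{(i e,-Te):e\in E\}$, with the maps induced by $x\mapsto(0,x)$ and $(g,x)\mapsto\sigma g$; for $S\in L(F',F)$ the *pullback* $\alpha S\in\mathrm{Ext}^1(F',E)$ has middle space $\{(g,x)\in G\oplus F':\sigma g=Sx\}$, with the maps $e\mapsto(ie,0)$ and $(g,x)\mapsto x$. Put $\alpha+\beta:=\nabla(\alpha\oplus\beta)\Delta$ with $\nabla(x,y)=x+y$, $\Delta(x)=(x,x)$, and $\lambda\alpha:=(\lambda I_E)\alpha$. **Theorem 1.** For all Banach spaces $F,E$ the spaces $S(F,E)$ and $R(F,E)$ are Banach spaces, and there are bijections $$\mu_{F,E}:\mathrm{Ext}^1(F,E)\to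 S(F,E)/\rho R(F,E)$$ with the following properties. 1. For every extension $0\to E\xrightarrow{i}G\xrightarrow{\sigma}F\to0$ there is $p\in R(F,G)$ with $\sigma p=I_F$ (a Bartle–Graves map), and for every such $p$ there is $\phi\in S(F,E)$ with $i\circ\phi=\rho p$, and $\mu_{F,E}$ sends the class of the extension to the class of $\phi$. 2. For every $\phi\in S(F,E)$, the class $\mu_{F,E}^{-1}([\phi])$ is represented by a twisted sum: an extension whose middle space is the Banach space $G=E\times F$ with componentwise multiplication by scalars, addition $(x_1,y_1)+(x_2,y_2)=(x_1+x_2-\phi(y_1,y_2),\,y_1+y_2)$, and the norm that is the gauge of the convex hull of $\{(x,0):\|x\|\le1\}\cup\{(0,y):\|y\|\le1\}$, and whose maps are $x\mapsto(x,0)$ and $(x,y)\mapsto y$. 3. The bijections form an isomorphism of bifunctors: $\mu_{F,E}(\alpha+\beta)=\mu_{F,E}(\alpha)+\mu_{F,E}(\beta)$ and $\mu_{F,E}(\lambda\alpha)=\lambda\mu_{F,E}(\alpha)$; and if $\mu_{F,E}(\alpha)=[\phi]$, then $\mu_{F,E'}(T\alpha)=[T\circ\phi]$ for every $T\in L(E,E')$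 and $\mu_{F',E}(\alpha S)=[\phi\circ(S\times S)]$ for every $S\in L(F',F)$. -/

import Mathlib

/-! Extensions of Banach spaces, factor systems, and the operations on both. All Banach spaces
are over a field `𝕜` that is `ℝ` or `ℂ`, and live in one universe `u`. -/

universe u v

namespace BanachExt

noncomputable section

variable (𝕜 : Type v) [RCLike 𝕜]
variable (F E : Type u) [NormedAddCommGroup F] [NormedSpace 𝕜 F]
  [NormedAddCommGroup E] [NormedSpace 𝕜 E]

/-! ### The space `R(F, E)` -/

/-- The continuous, homogeneous, bounded maps `F → E`, as a subspace of all maps. -/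
def homogeneousMaps : Submodule 𝕜 (F → E) where
  carrier := {h | Continuous h ∧ (∀ (c : 𝕜) (x : F), h (c • x) = c • h x) ∧
    ∃ C : ℝ, ∀ x, ‖h x‖ ≤ C * ‖x‖}
  zero_mem' := ⟨continuous_const, by simp, 0, by simp⟩
  add_mem' := by
    rintro f g ⟨hf, hf', C, hC⟩ ⟨hg, hg', D, hD⟩
    refine ⟨hf.add hg, fun c x => by simp [hf', hg'], C + D, fun x => ?_⟩
    calc ‖f x + g x‖ ≤ ‖f x‖ + ‖g x‖ := norm_add_le _ _
      _ ≤ C * ‖x‖ + D * ‖x‖ := add_le_add (hC x) (hD x)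
      _ = (C + D) * ‖x‖ := by ring
  smul_mem' := by
    rintro a f ⟨hf, hf', C, hC⟩
    refine ⟨hf.const_smul a, fun c x => by simp [hf', smul_comm a c], ‖a‖ * C, fun x => ?_⟩
    calc ‖a • f x‖ = ‖a‖ * ‖f x‖ := norm_smul _ _
      _ ≤ ‖a‖ * (C * ‖x‖) := mul_le_mul_of_nonneg_left (hC x) (norm_nonneg _)
      _ = ‖a‖ * C * ‖x‖ := by ring

/-- `R(F, E)`: continuous homogeneous bounded maps from `F` to `E`. -/
def HomogeneousMap : Type u := homogeneousMaps 𝕜 F E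

namespace HomogeneousMap

instance : AddCommGroup (HomogeneousMap 𝕜 F E) :=
  inferInstanceAs (AddCommGroup (homogeneousMaps 𝕜 F E))

instance : Module 𝕜 (HomogeneousMap 𝕜 F E) :=
  inferInstanceAs (Module 𝕜 (homogeneousMaps 𝕜 F E))

instance : CoeFun (HomogeneousMap 𝕜 F E) (fun _ => F → E) := ⟨fun h => h.1⟩

/-- `‖h‖ = sup_{x ≠ 0} ‖h x‖ / ‖x‖`. -/
instance : Norm (HomogeneousMap 𝕜 F E) := ⟨fun h => ⨆ x : {x : F // x ≠ 0}, ‖h x‖ / ‖(x : F)‖⟩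

variable {𝕜 F E}

theorem norm_def (h : HomogeneousMap 𝕜 F E) :
    ‖h‖ = ⨆ x : {x : F // x ≠ 0}, ‖h x‖ / ‖(x : F)‖ := rfl

theorem map_zero' (h : HomogeneousMap 𝕜 F E) : h 0 = 0 := by
  have := h.2.2.1 0 0
  simpa using this

theorem map_smul' (h : HomogeneousMap 𝕜 F E) (c : 𝕜) (x : F) : h (c • x) = c • h x := h.2.2.1 c x

theorem le_norm (h : HomogeneousMap 𝕜 F E) (x : F) : ‖h x‖ ≤ ‖h‖ * ‖x‖ := by
  by_cases hx : x = 0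
  · subst hx; simp [map_zero' h]
  · obtain ⟨C, hC⟩ := h.2.2.2
    have hb : BddAbove (Set.range fun x : {x : F // x ≠ 0} => ‖h x‖ / ‖(x : F)‖) := by
      refine ⟨C, ?_⟩
      rintro _ ⟨y, rfl⟩
      exact (div_le_iff₀ (norm_pos_iff.2 y.2)).2 (hC y)
    exact (div_le_iff₀ (norm_pos_iff.2 hx)).1 (le_ciSup hb ⟨x, hx⟩)

theorem norm_nonneg' (h : HomogeneousMap 𝕜 F E) : 0 ≤ ‖h‖ :=
  Real.iSup_nonneg fun _ => by positivity

theorem norm_le (h : HomogeneousMap 𝕜 F E) {C : ℝ} (hC : 0 ≤ C)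
    (H : ∀ x, ‖h x‖ ≤ C * ‖x‖) : ‖h‖ ≤ C :=
  Real.iSup_le (fun x => (div_le_iff₀ (norm_pos_iff.2 x.2)).2 (H x)) hC

theorem normCore : NormedSpace.Core 𝕜 (HomogeneousMap 𝕜 F E) where
  norm_nonneg := norm_nonneg'
  norm_smul c h := by
    rw [norm_def, norm_def, Real.mul_iSup_of_nonneg (norm_nonneg c)]
    refine iSup_congr fun x => ?_
    change ‖c • h x‖ / _ = _
    rw [norm_smul, mul_div_assoc]
  norm_triangle f g := by
    refine norm_le _ (add_nonneg (norm_nonneg' f) (norm_nonneg' g)) fun x => ?_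
    calc ‖f x + g x‖ ≤ ‖f x‖ + ‖g x‖ := norm_add_le _ _
      _ ≤ ‖f‖ * ‖x‖ + ‖g‖ * ‖x‖ := add_le_add (le_norm f x) (le_norm g x)
      _ = (‖f‖ + ‖g‖) * ‖x‖ := by ring
  norm_eq_zero_iff h := by
    constructor
    · intro h0
      refine Subtype.ext (funext fun x => ?_)
      have := le_norm h x
      rw [h0, zero_mul] at this
      exact norm_le_zero_iff.1 this
    · rintro rfl
      refine le_antisymm (norm_le _ le_rfl fun x => ?_) (norm_nonneg' _)
      change ‖(0 : E)‖ ≤ _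
      simp

instance : NormedAddCommGroup (HomogeneousMap 𝕜 F E) := NormedAddCommGroup.ofCore normCore

instance : NormedSpace 𝕜 (HomogeneousMap 𝕜 F E) := NormedSpace.ofCore normCore

end HomogeneousMap

/-! ### The space `S(F, E)` of factor systems -/

section FactorSystem

variable {F E}

/-- The iterated sum `∑_{k=1}^{n} φ (x₁ + ⋯ + x_k, x_{k+1})`; the vectors `x₁, x₂, …` are the
values `x 0, x 1, …`. -/
def iterSum (φ : F → F → E) (n : ℕ) (x : ℕ → F) : E :=
  ∑ k ∈ Finset.range n, φ (∑ i ∈ Finset.range (k + 1), x i) (x (k + 1))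

/-- `C ≥ 0` is a constant for which
`‖∑_{k=1}^{n} φ (x₁ + ⋯ + x_k, x_{k+1})‖ ≤ C * ∑_{i=1}^{n+1} ‖x_i‖` always holds. -/
def IsBoundFor (φ : F → F → E) (C : ℝ) : Prop :=
  0 ≤ C ∧ ∀ (n : ℕ) (x : ℕ → F), ‖iterSum φ n x‖ ≤ C * ∑ i ∈ Finset.range (n + 1), ‖x i‖

/-- Factor systems from `F` to `E`. -/
structure IsFactorSystem (φ : F → F → E) : Prop where
  continuous : Continuous fun z : F × F => φ z.1 z.2
  smul : ∀ (c : 𝕜) (x y : F), φ (c • x) (c • y) = c • φ x y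
  symm : ∀ x y, φ x y = φ y x
  zero : ∀ x, φ x 0 = 0
  cocycle : ∀ x y z, φ x y + φ (x + y) z = φ y z + φ x (y + z)
  bound : ∃ C, IsBoundFor φ C

theorem iterSum_add (φ ψ : F → F → E) (n : ℕ) (x : ℕ → F) :
    iterSum (φ + ψ) n x = iterSum φ n x + iterSum ψ n x := by
  simp [iterSum, Finset.sum_add_distrib]

variable {𝕜} in
theorem iterSum_smul (c : 𝕜) (φ : F → F → E) (n : ℕ) (x : ℕ → F) :
    iterSum (c • φ) n x = c • iterSum φ n x := by
  simp [iterSum, Finset.smul_sum]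

theorem IsBoundFor.add {φ ψ : F → F → E} {C D : ℝ} (hC : IsBoundFor φ C) (hD : IsBoundFor ψ D) :
    IsBoundFor (φ + ψ) (C + D) := by
  refine ⟨add_nonneg hC.1 hD.1, fun n x => ?_⟩
  rw [iterSum_add, add_mul]
  exact (norm_add_le _ _).trans (add_le_add (hC.2 n x) (hD.2 n x))

variable {𝕜} in
theorem IsBoundFor.smul {φ : F → F → E} {C : ℝ} (hC : IsBoundFor φ C) (c : 𝕜) :
    IsBoundFor (c • φ) (‖c‖ * C) := by
  refine ⟨mul_nonneg (norm_nonneg c) hC.1, fun n x => ?_⟩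
  rw [iterSum_smul, norm_smul, mul_assoc]
  exact mul_le_mul_of_nonneg_left (hC.2 n x) (norm_nonneg c)

variable (F E)

/-- The factor systems form a subspace of all maps of two variables. -/
def factorSystems : Submodule 𝕜 (F → F → E) where
  carrier := {φ | IsFactorSystem 𝕜 φ}
  zero_mem' :=
    { continuous := continuous_const
      smul := by simp
      symm := by simp
      zero := by simp
      cocycle := by simp
      bound := ⟨0, le_rfl, by simp [iterSum]⟩ }
  add_mem' := by
    intro φ ψ h h'
    obtain ⟨C, hC⟩ := h.bound
    obtain ⟨D, hD⟩ := h'.bound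
    exact
    { continuous := h.continuous.add h'.continuous
      smul := fun c x y => by simp [h.smul, h'.smul]
      symm := fun x y => by simp [h.symm x y, h'.symm x y]
      zero := fun x => by simp [h.zero, h'.zero]
      cocycle := fun x y z => by
        have h1 := h.cocycle x y z
        have h2 := h'.cocycle x y z
        simp only [Pi.add_apply]
        rw [add_add_add_comm, h1, h2, add_add_add_comm]
      bound := ⟨C + D, hC.add hD⟩ }
  smul_mem' := by
    intro c φ h
    obtain ⟨C, hC⟩ := h.bound
    exact
    { continuous := h.continuous.const_smul c
      smul := fun a x y => by simp [h.smul, smul_comm c a]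
      symm := fun x y => by simp [h.symm x y]
      zero := fun x => by simp [h.zero]
      cocycle := fun x y z => by
        simp only [Pi.smul_apply]
        rw [← smul_add, h.cocycle, smul_add]
      bound := ⟨‖c‖ * C, hC.smul c⟩ }

/-- `S(F, E)`: the space of factor systems from `F` to `E`. -/
def FactorSystem : Type u := factorSystems 𝕜 F E

end FactorSystem

namespace FactorSystem

instance : AddCommGroup (FactorSystem 𝕜 F E) :=
  inferInstanceAs (AddCommGroup (factorSystems 𝕜 F E))

instance : Module 𝕜 (FactorSystem 𝕜 F E) :=
  inferInstanceAs (Module 𝕜 (factorSystems 𝕜 F E))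

instance : CoeFun (FactorSystem 𝕜 F E) (fun _ => F → F → E) := ⟨fun φ => φ.1⟩

/-- `‖φ‖` is the infimum of the admissible constants. -/
instance : Norm (FactorSystem 𝕜 F E) := ⟨fun φ => sInf {C : ℝ | IsBoundFor φ C}⟩

variable {𝕜 F E}

theorem bddBelow (φ : F → F → E) : BddBelow {C : ℝ | IsBoundFor φ C} := ⟨0, fun _ hC => hC.1⟩

theorem norm_le (φ : FactorSystem 𝕜 F E) {C : ℝ} (hC : IsBoundFor φ C) : ‖φ‖ ≤ C :=
  csInf_le (bddBelow _) hC

theorem isBoundFor_norm (φ : FactorSystem 𝕜 F E) : IsBoundFor φ ‖φ‖ := by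
  obtain ⟨C, hC⟩ := φ.2.bound
  refine ⟨le_csInf ⟨C, hC⟩ fun _ h => h.1, fun n x => ?_⟩
  rcases (Finset.sum_nonneg fun i _ => norm_nonneg (x i) :
    0 ≤ ∑ i ∈ Finset.range (n + 1), ‖x i‖).eq_or_lt with h0 | h0
  · have := hC.2 n x
    rw [← h0, mul_zero] at this ⊢
    exact this
  · rw [← div_le_iff₀ h0]
    exact le_csInf ⟨C, hC⟩ fun D hD => (div_le_iff₀ h0).2 (hD.2 n x)

theorem norm_smul_le' (c : 𝕜) (φ : FactorSystem 𝕜 F E) : ‖c • φ‖ ≤ ‖c‖ * ‖φ‖ :=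
  norm_le _ ((isBoundFor_norm φ).smul c)

theorem normCore : NormedSpace.Core 𝕜 (FactorSystem 𝕜 F E) where
  norm_nonneg φ := (isBoundFor_norm φ).1
  norm_smul c φ := by
    refine le_antisymm (norm_smul_le' c φ) ?_
    by_cases hc : c = 0
    · subst hc
      rw [norm_zero, zero_mul]
      exact (isBoundFor_norm _).1
    · have h := norm_smul_le' c⁻¹ (c • φ)
      rw [smul_smul, inv_mul_cancel₀ hc, one_smul, norm_inv] at h
      have hc' : 0 < ‖c‖ := norm_pos_iff.2 hc
      calc ‖c‖ * ‖φ‖ ≤ ‖c‖ * (‖c‖⁻¹ * ‖c • φ‖) := mul_le_mul_of_nonneg_left h hc'.le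
        _ = ‖c • φ‖ := by rw [← mul_assoc, mul_inv_cancel₀ hc'.ne', one_mul]
  norm_triangle φ ψ := norm_le _ ((isBoundFor_norm φ).add (isBoundFor_norm ψ))
  norm_eq_zero_iff φ := by
    constructor
    · intro h0
      refine Subtype.ext (funext fun x => funext fun y => ?_)
      have h := (isBoundFor_norm φ).2 1 (fun i => if i = 0 then x else y)
      rw [h0, zero_mul] at h
      have h' := norm_le_zero_iff.1 h
      simp only [iterSum, Finset.sum_range_one, zero_add, if_true, one_ne_zero, if_false] at h'
      exact h'
    · rintro rfl
      refine le_antisymm (norm_le _ ⟨le_rfl, fun n x => ?_⟩) (isBoundFor_norm _).1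
      change ‖iterSum (0 : F → F → E) n x‖ ≤ _
      simp [iterSum]

instance : NormedAddCommGroup (FactorSystem 𝕜 F E) := NormedAddCommGroup.ofCore normCore

instance : NormedSpace 𝕜 (FactorSystem 𝕜 F E) := NormedSpace.ofCore normCore

end FactorSystem

/-! ### The operator `ρ` and its cokernel -/

variable {F E} in
/-- `(x, y) ↦ h (x + y) - h x - h y`. -/
def rhoFun (h : F → E) (x y : F) : E := h (x + y) - h x - h y

variable {F E} in
theorem iterSum_rhoFun (h : F → E) (n : ℕ) (x : ℕ → F) :
    iterSum (rhoFun h) n x =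
      h (∑ i ∈ Finset.range (n + 1), x i) - ∑ i ∈ Finset.range (n + 1), h (x i) := by
  induction n with
  | zero => simp [iterSum]
  | succ n ih =>
    rw [iterSum, Finset.sum_range_succ, ← iterSum, ih, rhoFun,
      Finset.sum_range_succ x (n + 1), Finset.sum_range_succ (fun i => h (x i)) (n + 1)]
    abel

variable {𝕜 F E} in
theorem rhoFun_mem (h : HomogeneousMap 𝕜 F E) : IsFactorSystem 𝕜 (rhoFun h) where
  continuous := by
    have := h.2.1
    unfold rhoFun
    fun_prop
  smul c x y := by
    have := h.2.2.1
    simp only [rhoFun, ← smul_add, this, ← smul_sub]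
  symm x y := by rw [rhoFun, rhoFun, add_comm x y]; abel
  zero x := by simp [rhoFun, HomogeneousMap.map_zero' h]
  cocycle x y z := by simp only [rhoFun, add_assoc]; abel
  bound := by
    refine ⟨‖h‖ + ‖h‖, by positivity, fun n x => ?_⟩
    rw [iterSum_rhoFun, add_mul]
    refine (norm_sub_le _ _).trans (add_le_add ?_ ?_)
    · exact (h.le_norm _).trans
        (mul_le_mul_of_nonneg_left (norm_sum_le _ _) (norm_nonneg h))
    · rw [Finset.mul_sum]
      exact (norm_sum_le _ _).trans (Finset.sum_le_sum fun i _ => h.le_norm _)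

/-- The operator `ρ : R(F, E) → S(F, E)`, `ρ h (x, y) = h (x + y) - h x - h y`. -/
def rho : HomogeneousMap 𝕜 F E →ₗ[𝕜] FactorSystem 𝕜 F E where
  toFun h := ⟨rhoFun h, rhoFun_mem h⟩
  map_add' f g := by
    refine Subtype.ext (funext fun x => funext fun y => ?_)
    change (f (x + y) + g (x + y)) - (f x + g x) - (f y + g y) =
      (f (x + y) - f x - f y) + (g (x + y) - g x - g y)
    abel
  map_smul' c f := by
    refine Subtype.ext (funext fun x => funext fun y => ?_)
    change c • f (x + y) - c • f x - c • f y = c • (f (x + y) - f x - f y)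
    rw [smul_sub, smul_sub]

/-- The cokernel `S(F, E) / ρ R(F, E)`. -/
abbrev Coker : Type u := FactorSystem 𝕜 F E ⧸ LinearMap.range (rho 𝕜 F E)

/-! ### Functoriality of `R`, `S` and the cokernel -/

section Functoriality

variable {𝕜} {F} {E} {F' E' : Type u} [NormedAddCommGroup F'] [NormedSpace 𝕜 F']
  [NormedAddCommGroup E'] [NormedSpace 𝕜 E']

/-- `h ↦ T ∘ h ∘ S` from `R(F, E)` to `R(F', E')`. -/
def HomogeneousMap.map (T : E →L[𝕜] E') (S : F' →L[𝕜] F) (h : HomogeneousMap 𝕜 F E) :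
    HomogeneousMap 𝕜 F' E' :=
  ⟨fun x => T (h (S x)), by
    refine ⟨T.continuous.comp (h.2.1.comp S.continuous), fun c x => ?_,
      ‖T‖ * (‖h‖ * ‖S‖), fun x => ?_⟩
    · change T (h (S (c • x))) = c • T (h (S x))
      rw [S.map_smul, h.map_smul', T.map_smul]
    · calc ‖T (h (S x))‖ ≤ ‖T‖ * ‖h (S x)‖ := T.le_opNorm _
        _ ≤ ‖T‖ * (‖h‖ * (‖S‖ * ‖x‖)) := by
          gcongr
          exact (h.le_norm _).trans (mul_le_mul_of_nonneg_left (S.le_opNorm x) (norm_nonneg h))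
        _ = ‖T‖ * (‖h‖ * ‖S‖) * ‖x‖ := by ring⟩

theorem IsFactorSystem.map {φ : F → F → E} (hφ : IsFactorSystem 𝕜 φ)
    (T : E →L[𝕜] E') (S : F' →L[𝕜] F) :
    IsFactorSystem 𝕜 (fun x y => T (φ (S x) (S y))) where
  continuous := T.continuous.comp
    (hφ.continuous.comp ((S.continuous.comp continuous_fst).prodMk
      (S.continuous.comp continuous_snd)))
  smul c x y := by rw [S.map_smul, S.map_smul, hφ.smul, T.map_smul]
  symm x y := by rw [hφ.symm]
  zero x := by rw [S.map_zero, hφ.zero, T.map_zero]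
  cocycle x y z := by rw [← T.map_add, S.map_add, S.map_add, hφ.cocycle, T.map_add]
  bound := by
    obtain ⟨C, hC0, hC⟩ := hφ.bound
    refine ⟨‖T‖ * (C * ‖S‖), by positivity, fun n x => ?_⟩
    have h1 : iterSum (fun x y => T (φ (S x) (S y))) n x = T (iterSum φ n (fun i => S (x i))) := by
      simp [iterSum, map_sum]
    rw [h1]
    calc ‖T (iterSum φ n fun i => S (x i))‖ ≤ ‖T‖ * ‖iterSum φ n fun i => S (x i)‖ :=
          T.le_opNorm _
      _ ≤ ‖T‖ * (C * ∑ i ∈ Finset.range (n + 1), ‖S‖ * ‖x i‖) := by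
          gcongr
          exact (hC n _).trans (mul_le_mul_of_nonneg_left
            (Finset.sum_le_sum fun i _ => S.le_opNorm _) hC0)
      _ = ‖T‖ * (C * ‖S‖) * ∑ i ∈ Finset.range (n + 1), ‖x i‖ := by
          rw [← Finset.mul_sum]; ring

/-- `φ ↦ T ∘ φ ∘ (S × S)` from `S(F, E)` to `S(F', E')`. -/
def FactorSystem.map (T : E →L[𝕜] E') (S : F' →L[𝕜] F) :
    FactorSystem 𝕜 F E →ₗ[𝕜] FactorSystem 𝕜 F' E' where
  toFun φ := ⟨fun x y => T (φ (S x) (S y)), φ.2.map T S⟩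
  map_add' φ ψ := Subtype.ext (funext fun x => funext fun y =>
    T.map_add (φ (S x) (S y)) (ψ (S x) (S y)))
  map_smul' c φ := Subtype.ext (funext fun x => funext fun y =>
    T.map_smul c (φ (S x) (S y)))

/-- The map induced on cokernels: the class of `φ` goes to the class of `T ∘ φ ∘ (S × S)`. -/
def Coker.map (T : E →L[𝕜] E') (S : F' →L[𝕜] F) : Coker 𝕜 F E →ₗ[𝕜] Coker 𝕜 F' E' :=
  Submodule.mapQ _ _ (FactorSystem.map T S) (by
    rintro _ ⟨h, rfl⟩
    refine ⟨HomogeneousMap.map T S h, Subtype.ext (funext fun x => funext fun y => ?_)⟩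
    change T (h (S (x + y))) - T (h (S x)) - T (h (S y)) = T (h (S x + S y) - h (S x) - h (S y))
    rw [S.map_add, T.map_sub, T.map_sub])

end Functoriality

/-! ### Extensions and congruence -/

/-- An extension `0 → E → G → F → 0` of Banach spaces: a short exact sequence with `G` a Banach
space and bounded linear maps. -/
structure Extension where
  /-- The middle space. -/
  G : Type u
  [instNormedAddCommGroup : NormedAddCommGroup G]
  [instNormedSpace : NormedSpace 𝕜 G]
  [instCompleteSpace : CompleteSpace G]
  /-- The embedding of `E`. -/
  i : E →L[𝕜] G
  /-- The quotient map onto `F`. -/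
  σ : G →L[𝕜] F
  injective : Function.Injective i
  exact : Function.Exact i σ
  surjective : Function.Surjective σ

attribute [instance] Extension.instNormedAddCommGroup Extension.instNormedSpace
  Extension.instCompleteSpace

variable {𝕜 F E}

/-- Congruence of extensions: an isomorphism of the middle spaces that makes the diagram with
the identities of `E` and `F` commute. -/
def Congruent (X Y : Extension 𝕜 F E) : Prop :=
  ∃ h : X.G ≃L[𝕜] Y.G, (∀ e, h (X.i e) = Y.i e) ∧ ∀ g, Y.σ (h g) = X.σ g

theorem congruent_equivalence : Equivalence (Congruent (𝕜 := 𝕜) (F := F) (E := E)) where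
  refl X := ⟨ContinuousLinearEquiv.refl 𝕜 X.G, by simp, by simp⟩
  symm := by
    rintro X Y ⟨h, h1, h2⟩
    refine ⟨h.symm, fun e => ?_, fun g => ?_⟩
    · rw [← h1, h.symm_apply_apply]
    · rw [← h2, h.apply_symm_apply]
  trans := by
    rintro X Y Z ⟨h, h1, h2⟩ ⟨k, k1, k2⟩
    exact ⟨h.trans k, fun e => by simp [h1, k1], fun g => by simp [k2, h2]⟩

variable (𝕜 F E) in
instance extSetoid : Setoid (Extension 𝕜 F E) := ⟨Congruent, congruent_equivalence⟩

variable (𝕜 F E) in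
/-- The set `Ext¹(F, E)` of congruence classes of extensions `0 → E → G → F → 0`. -/
def Ext : Type (max v (u + 1)) := Quotient (extSetoid 𝕜 F E)

/-- The congruence class of an extension. -/
def Extension.cls (X : Extension 𝕜 F E) : Ext 𝕜 F E := Quotient.mk _ X

/-- A bounded operator that makes the congruence diagram commute is an isomorphism. -/
theorem Congruent.of_map {X Y : Extension 𝕜 F E} (h : X.G →L[𝕜] Y.G)
    (h1 : ∀ e, h (X.i e) = Y.i e) (h2 : ∀ g, Y.σ (h g) = X.σ g) : Congruent X Y := by
  have hinj : h.ker = ⊥ := by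
    rw [LinearMap.ker_eq_bot']
    intro g hg
    replace hg : h g = 0 := hg
    obtain ⟨e, rfl⟩ := (X.exact g).1 (by rw [← h2, hg, map_zero])
    rw [h1] at hg
    rw [Y.injective (hg.trans (map_zero Y.i).symm), map_zero]
  have hsurj : h.range = ⊤ := by
    rw [LinearMap.range_eq_top]
    intro g
    obtain ⟨g', hg'⟩ := X.surjective (Y.σ g)
    obtain ⟨e, he⟩ := (Y.exact (g - h g')).1 (by rw [map_sub, h2, hg', sub_self])
    refine ⟨X.i e + g', ?_⟩
    change h (X.i e + g') = g
    rw [map_add, h1, he, sub_add_cancel]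
  exact ⟨ContinuousLinearEquiv.ofBijective h hinj hsurj, h1, h2⟩

/-! ### Pushout, pullback, direct sum -/

section Operations

variable {F' E' : Type u} [NormedAddCommGroup F'] [NormedSpace 𝕜 F']
  [NormedAddCommGroup E'] [NormedSpace 𝕜 E']

namespace Extension

/-- The map `e ↦ (i e, -T e)`, whose range is divided out in the pushout. -/
def pushMap (X : Extension 𝕜 F E) (T : E →L[𝕜] E') : E →L[𝕜] X.G × E' := X.i.prod (-T)

/-- The subspace `{(i e, -T e)}` of `G ⊕ E'`. -/
def pushGraph (X : Extension 𝕜 F E) (T : E →L[𝕜] E') : Submodule 𝕜 (X.G × E') :=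
  (X.pushMap T).range

theorem mem_pushGraph (X : Extension 𝕜 F E) (T : E →L[𝕜] E') (z : X.G × E') :
    z ∈ X.pushGraph T ↔ ∃ e, X.i e = z.1 ∧ -T e = z.2 := by
  constructor
  · rintro ⟨e, rfl⟩
    exact ⟨e, rfl, rfl⟩
  · rintro ⟨e, h1, h2⟩
    exact ⟨e, Prod.ext h1 h2⟩

variable [CompleteSpace E] in
theorem isClosed_pushGraph (X : Extension 𝕜 F E) (T : E →L[𝕜] E') :
    IsClosed (X.pushGraph T : Set (X.G × E')) := by
  have hr : IsClosed (Set.range X.i) := by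
    have : Set.range X.i = X.σ ⁻¹' {0} := by
      ext g
      exact (X.exact g).symm
    rw [this]
    exact isClosed_singleton.preimage X.σ.continuous
  obtain ⟨c, hc⟩ := X.i.antilipschitz_of_injective_of_isClosed_range X.injective hr
  have h2 : AntilipschitzWith c (X.pushMap T) := fun x y =>
    (hc x y).trans (mul_le_mul_right (le_max_left _ _) _)
  have hs : (X.pushGraph T : Set (X.G × E')) = Set.range (X.pushMap T) := LinearMap.coe_range _
  rw [hs]
  exact h2.isClosed_range (X.pushMap T).uniformContinuous

/-- The pushout `T X` of `0 → E → G → F → 0` along `T : E → E'`: the middle space is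
`(G ⊕ E') / {(i e, -T e)}`. -/
def push [CompleteSpace E] [CompleteSpace E'] (T : E →L[𝕜] E') (X : Extension 𝕜 F E) :
    Extension 𝕜 F E' :=
  haveI := X.isClosed_pushGraph T
  { G := (X.G × E') ⧸ X.pushGraph T
    i := (X.pushGraph T).mkQL ∘L ContinuousLinearMap.inr 𝕜 X.G E'
    σ := (X.pushGraph T).liftQL (X.σ ∘L ContinuousLinearMap.fst 𝕜 X.G E') (by
      rintro _ ⟨e, rfl⟩
      exact X.exact.apply_apply_eq_zero e)
    injective := by
      rw [injective_iff_map_eq_zero]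
      intro x hx
      obtain ⟨e, h1, h2⟩ :=
        (X.mem_pushGraph T _).1 ((Submodule.Quotient.mk_eq_zero (X.pushGraph T)).1 hx)
      have he : e = 0 := X.injective (h1.trans (map_zero X.i).symm)
      rw [he, map_zero, neg_zero] at h2
      exact h2.symm
    exact := by
      intro z
      obtain ⟨⟨g, x⟩, rfl⟩ := Submodule.Quotient.mk_surjective _ z
      constructor
      · intro h
        obtain ⟨e, rfl⟩ := (X.exact g).1 h
        refine ⟨x + T e, ?_⟩
        refine (Submodule.Quotient.eq (X.pushGraph T)).2 ((X.mem_pushGraph T _).2 ⟨-e, ?_, ?_⟩)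
        · simp
        · simp
      · rintro ⟨y, hy⟩
        rw [← hy]
        exact map_zero X.σ
    surjective := by
      intro y
      obtain ⟨g, rfl⟩ := X.surjective y
      exact ⟨Submodule.Quotient.mk (g, 0), rfl⟩ }

/-- The subspace `{(g, x) | σ g = S x}` of `G ⊕ F'`. -/
def pullSpace (X : Extension 𝕜 F E) (S : F' →L[𝕜] F) : Submodule 𝕜 (X.G × F') :=
  (X.σ ∘L ContinuousLinearMap.fst 𝕜 X.G F' - S ∘L ContinuousLinearMap.snd 𝕜 X.G F').ker

theorem mem_pullSpace (X : Extension 𝕜 F E) (S : F' →L[𝕜] F) (z : X.G × F') :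
    z ∈ X.pullSpace S ↔ X.σ z.1 = S z.2 := by
  rw [← sub_eq_zero]
  rfl

theorem isClosed_pullSpace (X : Extension 𝕜 F E) (S : F' →L[𝕜] F) :
    IsClosed (X.pullSpace S : Set (X.G × F')) :=
  ContinuousLinearMap.isClosed_ker _

/-- The pullback `X S` of `0 → E → G → F → 0` along `S : F' → F`: the middle space is
`{(g, x) ∈ G ⊕ F' | σ g = S x}`. -/
def pull [CompleteSpace F'] (X : Extension 𝕜 F E) (S : F' →L[𝕜] F) : Extension 𝕜 F' E :=
  haveI : CompleteSpace (X.pullSpace S) := (X.isClosed_pullSpace S).completeSpace_coe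
  { G := X.pullSpace S
    i := (ContinuousLinearMap.inl 𝕜 X.G F' ∘L X.i).codRestrict (X.pullSpace S) (fun e => by
      rw [mem_pullSpace]
      exact (X.exact.apply_apply_eq_zero e).trans (map_zero S).symm)
    σ := ContinuousLinearMap.snd 𝕜 X.G F' ∘L (X.pullSpace S).subtypeL
    injective := by
      intro a b hab
      exact X.injective (congrArg (fun z : X.pullSpace S => z.1.1) hab)
    exact := by
      rintro ⟨⟨g, x⟩, hz⟩
      rw [mem_pullSpace] at hz
      constructor
      · intro h
        replace h : x = 0 := h
        subst h
        obtain ⟨e, rfl⟩ := (X.exact g).1 (hz.trans (map_zero S))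
        exact ⟨e, rfl⟩
      · rintro ⟨e, he⟩
        exact (congrArg (fun z : X.pullSpace S => z.1.2) he).symm
    surjective := by
      intro x
      obtain ⟨g, hg⟩ := X.surjective (S x)
      exact ⟨⟨(g, x), (mem_pullSpace _ _ _).2 hg⟩, rfl⟩ }

/-- The direct sum `0 → E ⊕ E' → G₁ ⊕ G₂ → F ⊕ F' → 0` of two extensions. -/
def directSum (X : Extension 𝕜 F E) (Y : Extension 𝕜 F' E') :
    Extension 𝕜 (F × F') (E × E') where
  G := X.G × Y.G
  i := X.i.prodMap Y.i
  σ := X.σ.prodMap Y.σ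
  injective := X.injective.prodMap Y.injective
  exact := by
    rintro ⟨g, g'⟩
    constructor
    · intro h
      obtain ⟨e, rfl⟩ := (X.exact g).1 (congrArg Prod.fst h)
      obtain ⟨e', rfl⟩ := (Y.exact g').1 (congrArg Prod.snd h)
      exact ⟨(e, e'), rfl⟩
    · rintro ⟨⟨e, e'⟩, he⟩
      rw [← he]
      exact Prod.ext (X.exact.apply_apply_eq_zero e) (Y.exact.apply_apply_eq_zero e')
  surjective := X.surjective.prodMap Y.surjective

theorem push_congr [CompleteSpace E] [CompleteSpace E'] (T : E →L[𝕜] E')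
    {X Y : Extension 𝕜 F E} (h : Congruent X Y) : Congruent (X.push T) (Y.push T) := by
  obtain ⟨h, h1, h2⟩ := h
  refine Congruent.of_map (X := X.push T) (Y := Y.push T)
    ((X.pushGraph T).liftQL ((Y.pushGraph T).mkQL ∘L
      (h : X.G →L[𝕜] Y.G).prodMap (ContinuousLinearMap.id 𝕜 E')) ?_) ?_ ?_
  · rintro _ ⟨e, rfl⟩
    exact (Submodule.Quotient.mk_eq_zero (Y.pushGraph T)).2
      ((Y.mem_pushGraph T _).2 ⟨e, (h1 e).symm, rfl⟩)
  · intro e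
    change Submodule.Quotient.mk (h 0, e) = Submodule.Quotient.mk (0, e)
    rw [map_zero]
  · intro z
    obtain ⟨⟨g, x⟩, rfl⟩ := Submodule.Quotient.mk_surjective _ z
    exact h2 g

theorem pull_congr [CompleteSpace F'] (S : F' →L[𝕜] F)
    {X Y : Extension 𝕜 F E} (h : Congruent X Y) : Congruent (X.pull S) (Y.pull S) := by
  obtain ⟨h, h1, h2⟩ := h
  refine Congruent.of_map (X := X.pull S) (Y := Y.pull S)
    ((((h : X.G →L[𝕜] Y.G).prodMap (ContinuousLinearMap.id 𝕜 F')) ∘L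
      (X.pullSpace S).subtypeL).codRestrict (Y.pullSpace S) ?_) ?_ ?_
  · rintro ⟨⟨g, x⟩, hz⟩
    rw [mem_pullSpace] at hz ⊢
    exact (h2 g).trans hz
  · intro e
    exact Subtype.ext (Prod.ext (h1 e) rfl)
  · intro z
    rfl

theorem directSum_congr {X X' : Extension 𝕜 F E} {Y Y' : Extension 𝕜 F' E'}
    (h : Congruent X X') (k : Congruent Y Y') :
    Congruent (X.directSum Y) (X'.directSum Y') := by
  obtain ⟨h, h1, h2⟩ := h
  obtain ⟨k, k1, k2⟩ := k
  exact Congruent.of_map (X := X.directSum Y) (Y := X'.directSum Y')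
    ((h : X.G →L[𝕜] X'.G).prodMap (k : Y.G →L[𝕜] Y'.G))
    (fun e => Prod.ext (h1 e.1) (k1 e.2)) (fun g => Prod.ext (h2 g.1) (k2 g.2))

end Extension

namespace Ext

/-- `α ↦ T α` on congruence classes (pushout). -/
def push [CompleteSpace E] [CompleteSpace E'] (T : E →L[𝕜] E') : Ext 𝕜 F E → Ext 𝕜 F E' :=
  Quotient.map (Extension.push T) (fun _ _ h => Extension.push_congr T h)

/-- `α ↦ α S` on congruence classes (pullback). -/
def pull [CompleteSpace F'] (S : F' →L[𝕜] F) : Ext 𝕜 F E → Ext 𝕜 F' E :=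
  Quotient.map (fun X => X.pull S) (fun _ _ h => Extension.pull_congr S h)

/-- `α ⊕ β` on congruence classes. -/
def directSum : Ext 𝕜 F E → Ext 𝕜 F' E' → Ext 𝕜 (F × F') (E × E') :=
  Quotient.map₂ Extension.directSum (fun _ _ h _ _ k => Extension.directSum_congr h k)

/-- The Baer sum `∇ (α ⊕ β) Δ`. -/
instance [CompleteSpace E] [CompleteSpace F] : Add (Ext 𝕜 F E) :=
  ⟨fun α β => ((α.directSum β).push
    (ContinuousLinearMap.fst 𝕜 E E + ContinuousLinearMap.snd 𝕜 E E)).pull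
    ((ContinuousLinearMap.id 𝕜 F).prod (ContinuousLinearMap.id 𝕜 F))⟩

/-- The scalar multiple `(c I) α`. -/
instance [CompleteSpace E] : SMul 𝕜 (Ext 𝕜 F E) :=
  ⟨fun c α => α.push (c • ContinuousLinearMap.id 𝕜 E)⟩

end Ext

end Operations

/-! ### Right inverses and twisted sums -/

/-- `p` is a right inverse of the quotient map of `X` that is continuous, homogeneous and bounded
(a Bartle-Graves map). -/
def IsBartleGraves (X : Extension 𝕜 F E) (p : HomogeneousMap 𝕜 F X.G) : Prop :=
  ∀ y, X.σ (p y) = y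

/-- The extension `X` is, through the bijection `e : E × F → G`, the twisted sum given by `φ`:
* scalars act componentwise and
  `(x₁, y₁) + (x₂, y₂) = (x₁ + x₂ - φ (y₁, y₂), y₁ + y₂)`;
* the embedding is `x ↦ (x, 0)` and the quotient map is `(x, y) ↦ y`;
* the norm is the one whose unit ball is the convex hull of
  `{(x, 0) | ‖x‖ ≤ 1} ∪ {(0, y) | ‖y‖ ≤ 1}`, that is, the gauge of this convex hull. -/
structure IsTwistedSum (φ : F → F → E) (X : Extension 𝕜 F E) (e : E × F ≃ X.G) : Prop where
  add : ∀ z w : E × F, e z + e w = e (z.1 + w.1 - φ z.2 w.2, z.2 + w.2)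
  smul : ∀ (c : 𝕜) (z : E × F), c • e z = e (c • z.1, c • z.2)
  i_eq : ∀ x, X.i x = e (x, 0)
  σ_eq : ∀ z : E × F, X.σ (e z) = z.2
  norm_eq : letI : NormedSpace ℝ X.G := NormedSpace.restrictScalars ℝ 𝕜 X.G
    ∀ g, ‖g‖ = gauge (convexHull ℝ
      (e '' ({z | ‖z.1‖ ≤ 1 ∧ z.2 = 0} ∪ {z | z.1 = 0 ∧ ‖z.2‖ ≤ 1}))) g

end

end BanachExt

/-! An extension has a homogeneous continuous section `p`, although usually no linear one. The
defect `ρ p` of its additivity lies in the kernel of `σ`, which is the range of `i`, and the open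
mapping theorem makes `i` a homeomorphism onto its range; pulling `ρ p` back along `i` gives a
factor system. Two sections differ by an element of `R(F, E)`, so the class modulo `ρ R(F, E)`
depends only on the extension. The same comparison, made along a morphism of extensions
(`Represents.map_eq_map`), gives congruence invariance and both naturalities; the Baer sum follows
from these and the direct sum.

The section comes from three steps: approximate lifts on the unit sphere by partitions of unity,
corrected by a geometric iteration; an average over the compact group of unit scalars; radial
extension.

For injectivity, `(r, σ)` with `i r = id - p σ` gives coordinates on `G` in which addition is
twisted by `φ`. If two extensions have the same `φ`, then `i r + q σ`, with `r` from one and `i`,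
`q` from the other, is linear because the two defects cancel.

For surjectivity, the twisted sum must be a Banach space. The cocycle identity and symmetry make it
an abelian group, but `(a + b) z = a z + b z` amounts to `φ (a y, b y) = 0`, which is not an axiom.
It follows from the bound on iterated sums (`TwistedSum.eq_smul_of_norm_iterate_le`): a defect `d`
would enter the `n`-th iterate as `n a ^ (n - 1) d`, faster growth than the bound allows. The same
bound limits convex combinations of the generators whatever their number, so the gauge is a norm,
comparable to `‖x‖ + ‖y‖`. Completeness then uses the continuity of `φ`. -/

namespace BanachExt

open Filter Topology

/-! ### Completeness of `R(F, E)` and `S(F, E)`. -/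

section Completeness

variable {𝕜 : Type v} [RCLike 𝕜] {F E : Type u} [NormedAddCommGroup F] [NormedSpace 𝕜 F]
  [NormedAddCommGroup E] [NormedSpace 𝕜 E]

/-- The weight `B` is locally bounded, so approximation relative to `B` is locally uniform. With `B
= ‖x‖` or `‖x‖ + ‖y‖` this makes limits in `R` and `S` continuous. -/
theorem continuous_of_norm_sub_le_mul {Z V : Type*} [TopologicalSpace Z] [SeminormedAddCommGroup V]
    {f : Z → V} {B : Z → ℝ} (hB : Continuous B)
    (h : ∀ ε > 0, ∃ g : Z → V, Continuous g ∧ ∀ z, ‖f z - g z‖ ≤ ε * B z) : Continuous f := by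
  refine continuous_of_locally_uniform_approx_of_continuousAt fun z U hU => ?_
  obtain ⟨δ, hδ, hU⟩ := Metric.mem_uniformity_dist.1 hU
  obtain ⟨g, hg, hfg⟩ := h (δ / (|B z| + 1)) (by positivity)
  have hz : ∀ᶠ w in 𝓝 z, B w < |B z| + 1 :=
    hB.continuousAt.eventually_lt continuousAt_const (by linarith [le_abs_self (B z)])
  refine ⟨_, hz, g, hg.continuousAt, fun w hw => hU ?_⟩
  rw [dist_eq_norm]
  calc ‖f w - g w‖ ≤ δ / (|B z| + 1) * B w := hfg w
    _ < δ / (|B z| + 1) * (|B z| + 1) := mul_lt_mul_of_pos_left hw (by positivity)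
    _ = δ := div_mul_cancel₀ _ (by positivity)

theorem HomogeneousMap.completeSpace [CompleteSpace E] :
    CompleteSpace (HomogeneousMap 𝕜 F E) := by
  refine Metric.complete_of_cauchySeq_tendsto fun u hu => ?_
  have hsub : ∀ m n x, ‖u m x - u n x‖ ≤ ‖u m - u n‖ * ‖x‖ := fun m n x => (u m - u n).le_norm x
  have hlim : ∀ x, ∃ y, Tendsto (fun n => u n x) atTop (𝓝 y) := fun x => by
    refine cauchySeq_tendsto_of_complete (Metric.cauchySeq_iff.2 fun ε hε => ?_)
    -- The added 1 covers `x = 0`.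
    obtain ⟨N, hN⟩ := Metric.cauchySeq_iff.1 hu (ε / (‖x‖ + 1)) (by positivity)
    refine ⟨N, fun m hm n hn => ?_⟩
    rw [dist_eq_norm]
    have h1 := hN m hm n hn
    rw [dist_eq_norm, lt_div_iff₀ (by positivity)] at h1
    nlinarith [hsub m n x, norm_nonneg (u m - u n)]
  choose f hf using hlim
  have happrox : ∀ ε > 0, ∃ N, ∀ n ≥ N, ∀ x, ‖f x - u n x‖ ≤ ε * ‖x‖ := by
    intro ε hε
    obtain ⟨N, hN⟩ := Metric.cauchySeq_iff.1 hu ε hε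
    refine ⟨N, fun n hn x => ?_⟩
    refine le_of_tendsto ((hf x).sub_const (u n x)).norm
      ((eventually_ge_atTop N).mono fun m hm => (hsub m n x).trans ?_)
    gcongr
    rw [← dist_eq_norm]
    exact (hN m hm n hn).le
  have hmem : f ∈ homogeneousMaps 𝕜 F E := by
    refine ⟨continuous_of_norm_sub_le_mul continuous_norm fun ε hε => ?_, fun c x => ?_, ?_⟩
    · obtain ⟨N, hN⟩ := happrox ε hε
      exact ⟨u N, (u N).2.1, hN N le_rfl⟩
    · refine tendsto_nhds_unique (hf (c • x)) ?_
      simpa only [HomogeneousMap.map_smul'] using (hf x).const_smul c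
    · obtain ⟨N, hN⟩ := happrox 1 one_pos
      refine ⟨1 + ‖u N‖, fun x => ?_⟩
      linarith [hN N le_rfl x, (u N).le_norm x, norm_le_norm_add_norm_sub' (f x) (u N x)]
  let g : HomogeneousMap 𝕜 F E := ⟨f, hmem⟩
  refine ⟨g, Metric.tendsto_atTop.2 fun ε hε => ?_⟩
  obtain ⟨N, hN⟩ := happrox (ε / 2) (half_pos hε)
  refine ⟨N, fun n hn => ?_⟩
  rw [dist_comm, dist_eq_norm]
  exact (HomogeneousMap.norm_le _ (half_pos hε).le fun x => hN n hn x).trans_lt (half_lt_self hε)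

/-- The case of two vectors: the norm of `S(F, E)` controls pointwise values, hence pointwise
limits. -/
theorem IsBoundFor.norm_apply_le {φ : F → F → E} {C : ℝ} (h : IsBoundFor φ C) (x y : F) :
    ‖φ x y‖ ≤ C * (‖x‖ + ‖y‖) := by
  simpa [iterSum, Finset.sum_range_succ] using h.2 1 (fun i => if i = 0 then x else y)

theorem FactorSystem.completeSpace [CompleteSpace E] :
    CompleteSpace (FactorSystem 𝕜 F E) := by
  refine Metric.complete_of_cauchySeq_tendsto fun u hu => ?_
  have hsub : ∀ m n x y, ‖u m x y - u n x y‖ ≤ ‖u m - u n‖ * (‖x‖ + ‖y‖) := fun m n =>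
    (isBoundFor_norm (u m - u n)).norm_apply_le
  have hlim : ∀ x y, ∃ z, Tendsto (fun n => u n x y) atTop (𝓝 z) := fun x y => by
    refine cauchySeq_tendsto_of_complete (Metric.cauchySeq_iff.2 fun ε hε => ?_)
    obtain ⟨N, hN⟩ := Metric.cauchySeq_iff.1 hu (ε / (‖x‖ + ‖y‖ + 1)) (by positivity)
    refine ⟨N, fun m hm n hn => ?_⟩
    rw [dist_eq_norm]
    have h1 := hN m hm n hn
    rw [dist_eq_norm, lt_div_iff₀ (by positivity)] at h1
    nlinarith [hsub m n x y, norm_nonneg (u m - u n)]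
  choose f hf using hlim
  have happrox : ∀ ε > 0, ∃ N, ∀ n ≥ N, IsBoundFor (f - (u n).1) ε := by
    intro ε hε
    obtain ⟨N, hN⟩ := Metric.cauchySeq_iff.1 hu ε hε
    refine ⟨N, fun n hn => ⟨hε.le, fun k x => ?_⟩⟩
    -- For fixed vectors the iterated sum is a finite sum of values, so pointwise convergence passes
    -- to it and the bound survives the limit.
    have ht : Tendsto (fun m => iterSum (u m - u n).1 k x) atTop (𝓝 (iterSum (f - (u n).1) k x)) :=
      tendsto_finsetSum _ fun i _ => (hf _ _).sub_const _
    refine le_of_tendsto ht.norm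
      ((eventually_ge_atTop N).mono fun m hm => ((isBoundFor_norm (u m - u n)).2 k x).trans ?_)
    gcongr
    rw [← dist_eq_norm]
    exact (hN m hm n hn).le
  have hmem : IsFactorSystem 𝕜 f :=
    { continuous := by
        refine continuous_of_norm_sub_le_mul (B := fun z : F × F => ‖z.1‖ + ‖z.2‖)
          (by fun_prop) fun ε hε => ?_
        obtain ⟨N, hN⟩ := happrox ε hε
        exact ⟨_, (u N).2.continuous, fun z => (hN N le_rfl).norm_apply_le z.1 z.2⟩
      smul := fun c x y => by
        refine tendsto_nhds_unique (hf (c • x) (c • y)) ?_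
        simpa only [(u _).2.smul] using (hf x y).const_smul c
      symm := fun x y => by
        refine tendsto_nhds_unique (hf x y) ((hf y x).congr fun n => (u n).2.symm y x)
      zero := fun x => tendsto_nhds_unique (hf x 0)
        (tendsto_const_nhds.congr fun n => ((u n).2.zero x).symm)
      cocycle := fun x y z => tendsto_nhds_unique ((hf x y).add (hf (x + y) z))
        (((hf y z).add (hf x (y + z))).congr fun n => ((u n).2.cocycle x y z).symm)
      bound := by
        obtain ⟨N, hN⟩ := happrox 1 one_pos
        have := (hN N le_rfl).add (isBoundFor_norm (u N))
        rw [sub_add_cancel] at this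
        exact ⟨_, this⟩ }
  let g : FactorSystem 𝕜 F E := ⟨f, hmem⟩
  refine ⟨g, Metric.tendsto_atTop.2 fun ε hε => ?_⟩
  obtain ⟨N, hN⟩ := happrox (ε / 2) (half_pos hε)
  refine ⟨N, fun n hn => ?_⟩
  rw [dist_comm, dist_eq_norm]
  exact (norm_le _ (hN n hn)).trans_lt (half_lt_self hε)

end Completeness

/-! ### Continuous lifts through surjective operators. -/

section Selection

open Metric

open scoped BoundedContinuousFunction

/-- The iteration from the open mapping theorem: each correction halves the residual, and the
corrections form an absolutely convergent series. -/
theorem surjective_of_approx_preimage {V W : Type*} [NormedAddCommGroup V] [NormedSpace ℝ V]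
    [CompleteSpace V] [NormedAddCommGroup W] [NormedSpace ℝ W] (L : V →L[ℝ] W) (C : ℝ)
    (h : ∀ w, ∃ v, ‖v‖ ≤ C * ‖w‖ ∧ ‖w - L v‖ ≤ 1 / 2 * ‖w‖) : Function.Surjective L := by
  choose g hg hr using h
  intro w
  let r : W → W := fun w => w - L (g w)
  have hnorm : ∀ n, ‖r^[n] w‖ ≤ (1 / 2) ^ n * ‖w‖ := by
    intro n
    induction n with
    | zero => simp
    | succ n ih =>
      rw [Function.iterate_succ_apply', pow_succ']
      linarith [hr (r^[n] w)]
  have hsum : Summable fun n => g (r^[n] w) := by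
    refine Summable.of_norm_bounded (g := fun n => (1 / 2 : ℝ) ^ n * (|C| * ‖w‖))
      ((summable_geometric_of_lt_one (by norm_num) (by norm_num)).mul_right _) fun n => ?_
    calc ‖g (r^[n] w)‖ ≤ C * ‖r^[n] w‖ := hg _
      _ ≤ |C| * ((1 / 2) ^ n * ‖w‖) := by
        gcongr
        exacts [le_abs_self C, hnorm n]
      _ = _ := by ring
  refine ⟨∑' n, g (r^[n] w), ?_⟩
  have hpart : ∀ n, ∑ k ∈ Finset.range n, L (g (r^[k] w)) = w - r^[n] w := by
    intro n
    induction n with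
    | zero => simp
    | succ n ih =>
      rw [Finset.sum_range_succ, ih, Function.iterate_succ_apply']
      simp only [r]
      abel
  have hlim : Tendsto (fun n => r^[n] w) atTop (𝓝 0) := by
    refine squeeze_zero_norm hnorm ?_
    simpa using (tendsto_pow_atTop_nhds_zero_of_lt_one (r := (1 / 2 : ℝ)) (by norm_num)
      (by norm_num)).mul_const ‖w‖
  refine tendsto_nhds_unique (hsum.hasSum.mapL L).tendsto_sum_nat ?_
  simpa only [hpart, sub_zero] using hlim.const_sub w

variable {Y G H : Type*} [TopologicalSpace Y] [NormedAddCommGroup G] [NormedSpace ℝ G]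
  [NormedAddCommGroup H] [NormedSpace ℝ H]

theorem exists_approx_continuous_lift [NormalSpace Y] [ParacompactSpace Y] (T : G →L[ℝ] H) {C : ℝ}
    (hC0 : 0 ≤ C) (hC : ∀ y, ∃ x, T x = y ∧ ‖x‖ ≤ C * ‖y‖) (f : Y →ᵇ H) :
    ∃ g : Y →ᵇ G, ‖g‖ ≤ C * ‖f‖ ∧
      ‖f - T.compLeftContinuousBounded Y g‖ ≤ 1 / 2 * ‖f‖ := by
  rcases (norm_nonneg f).eq_or_lt with h0 | h0
  -- The zero map is treated apart because the local argument needs a tolerance `‖f‖ / 2 > 0`.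
  · exact ⟨0, by simp [← h0], by simp [← h0]⟩
  -- The admissible values at `y` form a convex set, and a preimage of `f y` of controlled norm
  -- stays admissible near `y`; a partition of unity glues these local constants.
  obtain ⟨g, hg⟩ := exists_continuous_forall_mem_convex_of_local_const
    (t := fun y => closedBall (0 : G) (C * ‖f‖) ∩ T ⁻¹' closedBall (f y) (1 / 2 * ‖f‖))
    (fun y => (convex_closedBall _ _).inter
      ((convex_closedBall _ _).is_linear_preimage T.toLinearMap.isLinear)) (fun y => by
        obtain ⟨x, hx, hxC⟩ := hC (f y)
        refine ⟨x, ?_⟩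
        have h1 : ∀ᶠ z in 𝓝 y, dist (f z) (f y) < 1 / 2 * ‖f‖ :=
          (Metric.tendsto_nhds.1 f.continuous.continuousAt) _ (by positivity)
        filter_upwards [h1] with z hz
        refine ⟨?_, ?_⟩
        · rw [mem_closedBall_zero_iff]
          exact hxC.trans (mul_le_mul_of_nonneg_left (f.norm_coe_le_norm y) hC0)
        · rw [Set.mem_preimage, hx, mem_closedBall, dist_comm]
          exact hz.le)
  have hb : ∀ y, ‖g y‖ ≤ C * ‖f‖ := fun y => mem_closedBall_zero_iff.1 (hg y).1
  refine ⟨BoundedContinuousFunction.ofNormedAddCommGroup g g.continuous _ hb,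
    BoundedContinuousFunction.norm_ofNormedAddCommGroup_le _ (by positivity) _, ?_⟩
  refine (BoundedContinuousFunction.norm_le (by positivity)).2 fun y => ?_
  have := (hg y).2
  rw [Set.mem_preimage, mem_closedBall, dist_comm, dist_eq_norm] at this
  exact this

/-- Composition with `T` is itself an operator between Banach spaces of bounded continuous maps;
approximate lifts make it surjective. -/
theorem exists_continuous_lift [NormalSpace Y] [ParacompactSpace Y] [CompleteSpace G]
    [CompleteSpace H] (T : G →L[ℝ] H) (hT : Function.Surjective T) (f : Y →ᵇ H) :
    ∃ g : Y →ᵇ G, ∀ y, T (g y) = f y := by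
  obtain ⟨C, hC0, hC⟩ := T.exists_preimage_norm_le hT
  obtain ⟨g, hg⟩ := surjective_of_approx_preimage (T.compLeftContinuousBounded Y) C
    (exists_approx_continuous_lift T hC0.le hC) f
  exact ⟨g, fun y => DFunLike.congr_fun hg y⟩

end Selection

/-! ### Homogeneous right inverses of surjective operators. -/

section BartleGraves

open Metric

open MeasureTheory
open scoped BoundedContinuousFunction

variable {𝕜 : Type v} [RCLike 𝕜] {G H : Type u} [NormedAddCommGroup G] [NormedSpace 𝕜 G]
  [NormedAddCommGroup H] [NormedSpace 𝕜 H]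

/-- Averaging over the unit scalars turns a continuous bounded map on the unit sphere into one
that commutes with unit scalars, and keeps right inverses of linear maps. -/
theorem exists_equivariant_lift [CompleteSpace G] [CompleteSpace H] (T : G →L[𝕜] H)
    (g : sphere (0 : H) 1 →ᵇ G) (hg : ∀ y, T (g y) = y) :
    ∃ k : sphere (0 : H) 1 →ᵇ G, (∀ y, T (k y) = y) ∧
      ∀ (c : sphere (0 : 𝕜) 1) y, k (c • y) = (c : 𝕜) • k y := by
  let : NormedSpace ℝ G := NormedSpace.restrictScalars ℝ 𝕜 G
  let : NormedSpace ℝ H := NormedSpace.restrictScalars ℝ 𝕜 H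
  let : MeasurableSpace (sphere (0 : 𝕜) 1) := borel _
  have : BorelSpace (sphere (0 : 𝕜) 1) := ⟨rfl⟩
  -- The unit scalars form a compact abelian group; Haar measure is normalised to total mass one, so
  -- averaging fixes constants.
  let ν : Measure (sphere (0 : 𝕜) 1) := Measure.haarMeasure ⊤
  have : IsProbabilityMeasure ν := ⟨Measure.haarMeasure_self⟩
  let q : sphere (0 : H) 1 → sphere (0 : 𝕜) 1 → G := fun y c =>
    ((c⁻¹ : sphere (0 : 𝕜) 1) : 𝕜) • g (c • y)
  have hq1 : ∀ y, Continuous (q y) := fun y =>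
    (continuous_subtype_val.comp continuous_inv).smul
      (g.continuous.comp (continuous_id.smul continuous_const))
  have hq2 : ∀ c, Continuous fun y => q y c := fun c => by fun_prop
  have hq3 : ∀ y c, ‖q y c‖ ≤ ‖g‖ := fun y c => by
    simp only [q, norm_smul, norm_eq_of_mem_sphere, one_mul]
    exact g.norm_coe_le_norm _
  have hint : ∀ y, Integrable (q y) ν := fun y =>
    Integrable.of_bound (hq1 y).aestronglyMeasurable ‖g‖ (ae_of_all _ (hq3 y))
  have hcont : Continuous fun y => ∫ c, q y c ∂ν :=
    continuous_of_dominated (fun y => (hq1 y).aestronglyMeasurable)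
      (fun y => ae_of_all _ (hq3 y)) (integrable_const ‖g‖) (ae_of_all _ hq2)
  refine ⟨BoundedContinuousFunction.ofNormedAddCommGroup _ hcont ‖g‖ fun y => ?_,
    fun y => ?_, fun c y => ?_⟩
  · exact (norm_integral_le_of_norm_le_const (ae_of_all _ (hq3 y))).trans (by simp)
  · change T (∫ c, q y c ∂ν) = y
    rw [← T.integral_comp_comm (hint y)]
    have : ∀ c, T (q y c) = y := fun c => by
      have hc : (c : 𝕜) ≠ 0 := ne_zero_of_mem_unit_sphere c
      simp only [q, map_smul, hg]
      change (c : 𝕜)⁻¹ • (c : 𝕜) • (y : H) = y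
      rw [smul_smul, inv_mul_cancel₀ hc, one_smul]
    simp [this]
  · change ∫ b, q (c • y) b ∂ν = (c : 𝕜) • ∫ b, q y b ∂ν
    -- The substitution `b ↦ b c` reduces equivariance to the pointwise identity `q (c y) b = c q y
    -- (b c)`.
    rw [← integral_smul, ← integral_mul_right_eq_self (fun b => (c : 𝕜) • q y b) c]
    refine integral_congr_ae (ae_of_all _ fun b => ?_)
    have hc : (c : 𝕜) ≠ 0 := ne_zero_of_mem_unit_sphere c
    have hb : (b : 𝕜) ≠ 0 := ne_zero_of_mem_unit_sphere b
    change (b : 𝕜)⁻¹ • g (b • c • y) = (c : 𝕜) • ((b : 𝕜) * (c : 𝕜))⁻¹ • g ((b * c) • y)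
    have hbc : (b : 𝕜)⁻¹ = (c : 𝕜) * ((b : 𝕜) * (c : 𝕜))⁻¹ := by field_simp
    rw [hbc, mul_smul, mul_smul b c y]

/-- The homogeneous extension `y ↦ ‖y‖ • k (y / ‖y‖)` of a map on the unit sphere that commutes with
unit scalars. -/
theorem exists_homogeneous_extension (k : sphere (0 : H) 1 →ᵇ G)
    (hk : ∀ (c : sphere (0 : 𝕜) 1) y, k (c • y) = (c : 𝕜) • k y) :
    ∃ p : HomogeneousMap 𝕜 H G, ∀ y : sphere (0 : H) 1, p y = k y := by
  classical
  have hsph : ∀ y : H, y ≠ 0 → ((‖y‖⁻¹ : ℝ) : 𝕜) • y ∈ sphere (0 : H) 1 := fun y hy => by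
    have := norm_ne_zero_iff.2 hy
    simp [norm_smul, this]
  let n : {y : H // y ≠ 0} → sphere (0 : H) 1 := fun y => ⟨_, hsph y y.2⟩
  let p : H → G := fun y => if hy : y = 0 then 0 else ((‖y‖ : ℝ) : 𝕜) • k (n ⟨y, hy⟩)
  have hp0 : p 0 = 0 := dif_pos rfl
  have hp : ∀ y : {y : H // y ≠ 0}, p y = ((‖(y : H)‖ : ℝ) : 𝕜) • k (n y) := fun y => dif_neg y.2
  have hbound : ∀ y, ‖p y‖ ≤ ‖k‖ * ‖y‖ := fun y => by
    by_cases hy : y = 0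
    · simp [hy, hp0]
    · rw [hp ⟨y, hy⟩, norm_smul, mul_comm]
      simp only [RCLike.norm_ofReal, abs_norm]
      exact mul_le_mul_of_nonneg_right (k.norm_coe_le_norm _) (norm_nonneg y)
  have hncont : Continuous n := by
    refine Continuous.subtype_mk ?_ _
    exact (RCLike.continuous_ofReal.comp
      (continuous_subtype_val.norm.inv₀ fun y => norm_ne_zero_iff.2 y.2)).smul
        continuous_subtype_val
  have hcont : Continuous p := by
    refine continuous_iff_continuousAt.2 fun y => ?_
    by_cases hy : y = 0
    -- At the origin the normalisation is singular, and continuity comes from the linear bound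
    -- alone.
    · subst hy
      rw [ContinuousAt, hp0]
      refine squeeze_zero_norm hbound ?_
      simpa using (continuous_norm.tendsto (0 : H)).const_mul ‖k‖
    · have : ContinuousOn p {y : H | y ≠ 0} := by
        rw [continuousOn_iff_continuous_domRestrict]
        have h2 : Continuous fun y : {y : H // y ≠ 0} => ((‖(y : H)‖ : ℝ) : 𝕜) • k (n y) :=
          (RCLike.continuous_ofReal.comp continuous_subtype_val.norm).smul
            (k.continuous.comp hncont)
        exact h2.congr fun y => (hp y).symm
      exact this.continuousAt (isOpen_ne.mem_nhds hy)
  refine ⟨⟨p, hcont, fun c y => ?_, ‖k‖, hbound⟩, fun y => ?_⟩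
  · by_cases hc : c = 0
    · simp [hc, hp0]
    by_cases hy : y = 0
    · simp [hy, hp0]
    have hcn : (‖c‖ : ℝ) ≠ 0 := norm_ne_zero_iff.2 hc
    have hcn' : ((‖c‖ : ℝ) : 𝕜) ≠ 0 := RCLike.ofReal_ne_zero.2 hcn
    have hyn : ((‖y‖ : ℝ) : 𝕜) ≠ 0 := RCLike.ofReal_ne_zero.2 (norm_ne_zero_iff.2 hy)
    -- Normalising `c y` multiplies the direction of `y` by the phase `c / ‖c‖`, to which
    -- equivariance applies.
    have hu : ((‖c‖⁻¹ : ℝ) : 𝕜) * c ∈ sphere (0 : 𝕜) 1 := by simp [hcn]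
    have hn : n ⟨c • y, smul_ne_zero hc hy⟩ = (⟨_, hu⟩ : sphere (0 : 𝕜) 1) • n ⟨y, hy⟩ := by
      refine Subtype.ext ?_
      change ((‖c • y‖⁻¹ : ℝ) : 𝕜) • c • y =
        (((‖c‖⁻¹ : ℝ) : 𝕜) * c) • ((‖y‖⁻¹ : ℝ) : 𝕜) • y
      rw [norm_smul, smul_smul, smul_smul]
      congr 1
      push_cast
      rw [mul_inv]
      ring
    rw [hp ⟨c • y, smul_ne_zero hc hy⟩, hp ⟨y, hy⟩, hn, hk, smul_smul, smul_smul]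
    congr 1
    simp only [norm_smul]
    push_cast
    field_simp
  · have hy : (y : H) ≠ 0 := ne_zero_of_mem_unit_sphere y
    have hn : n ⟨y, hy⟩ = y := Subtype.ext (by simp [n])
    change p y = k y
    rw [hp ⟨y, hy⟩, hn]
    simp

theorem exists_homogeneous_rightInverse [CompleteSpace G] [CompleteSpace H] (T : G →L[𝕜] H)
    (hT : Function.Surjective T) : ∃ p : HomogeneousMap 𝕜 H G, ∀ y, T (p y) = y := by
  let : NormedSpace ℝ G := NormedSpace.restrictScalars ℝ 𝕜 G
  let : NormedSpace ℝ H := NormedSpace.restrictScalars ℝ 𝕜 H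
  obtain ⟨g, hg⟩ := exists_continuous_lift (Y := sphere (0 : H) 1) (T.restrictScalars ℝ) hT
    (BoundedContinuousFunction.ofNormedAddCommGroup Subtype.val continuous_subtype_val 1
      fun y => (norm_eq_of_mem_sphere y).le)
  obtain ⟨k, hTk, hk⟩ := exists_equivariant_lift T g hg
  obtain ⟨p, hp⟩ := exists_homogeneous_extension k hk
  refine ⟨p, fun y => ?_⟩
  by_cases hy : y = 0
  · rw [hy, p.map_zero', map_zero]
  have hn := norm_ne_zero_iff.2 hy
  have hs : ((‖y‖⁻¹ : ℝ) : 𝕜) • y ∈ sphere (0 : H) 1 := by simp [norm_smul, hn]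
  have h1 := hTk ⟨_, hs⟩
  rw [← hp, p.map_smul', map_smul] at h1
  exact smul_right_injective _ (RCLike.ofReal_ne_zero.2 (inv_ne_zero hn)) h1

end BartleGraves

/-! ### Factor systems of extensions and comparison of sections. -/

section Representation

variable {𝕜 : Type v} [RCLike 𝕜] {F E F' E' : Type u}
  [NormedAddCommGroup F] [NormedSpace 𝕜 F] [NormedAddCommGroup E] [NormedSpace 𝕜 E]
  [NormedAddCommGroup F'] [NormedSpace 𝕜 F'] [NormedAddCommGroup E'] [NormedSpace 𝕜 E']

/-- The range of `i` is the closed kernel of `σ`, so the open mapping theorem applies. Continuity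
and bounds of maps into that kernel can thus be read in `E`. -/
theorem Extension.exists_antilipschitz [CompleteSpace E] (X : Extension 𝕜 F E) :
    ∃ c, AntilipschitzWith c X.i := by
  refine X.i.antilipschitz_of_injective_of_isClosed_range X.injective ?_
  have : Set.range X.i = X.σ ⁻¹' {0} := by
    ext g
    exact (X.exact g).symm
  rw [this]
  exact isClosed_singleton.preimage X.σ.continuous

theorem Extension.isInducing_i [CompleteSpace E] (X : Extension 𝕜 F E) : IsInducing X.i := by
  obtain ⟨c, hc⟩ := X.exists_antilipschitz
  exact (hc.isUniformInducing X.i.uniformContinuous).isInducing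

theorem Extension.exists_isBartleGraves [CompleteSpace F] (X : Extension 𝕜 F E) :
    ∃ p, IsBartleGraves X p :=
  exists_homogeneous_rightInverse X.σ X.surjective

/-- A homogeneous map into the kernel of the quotient map factors through the embedding. -/
theorem Extension.exists_homogeneousMap_of_σ_eq_zero [CompleteSpace E] (X : Extension 𝕜 F E)
    (q : HomogeneousMap 𝕜 F' X.G) (hq : ∀ x, X.σ (q x) = 0) :
    ∃ h : HomogeneousMap 𝕜 F' E, ∀ x, X.i (h x) = q x := by
  choose f hf using fun x => (X.exact (q x)).1 (hq x)
  obtain ⟨c, hc⟩ := X.exists_antilipschitz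
  refine ⟨⟨f, ?_, fun a x => X.injective ?_, c * ‖q‖, fun x => ?_⟩, hf⟩
  · rw [X.isInducing_i.continuous_iff]
    exact q.2.1.congr fun x => (hf x).symm
  · rw [hf, map_smul, hf, q.map_smul']
  · calc ‖f x‖ ≤ c * ‖X.i (f x)‖ := hc.le_mul_norm (map_zero X.i) _
      _ ≤ c * (‖q‖ * ‖x‖) := by
        rw [hf]
        exact mul_le_mul_of_nonneg_left (q.le_norm x) c.2
      _ = c * ‖q‖ * ‖x‖ := by ring

/-- The factor system `φ` comes from a Bartle-Graves map of the extension `X`. -/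
def Represents (X : Extension 𝕜 F E) (φ : FactorSystem 𝕜 F E) : Prop :=
  ∃ p, IsBartleGraves X p ∧ ∀ x y, X.i (φ x y) = rho 𝕜 F X.G p x y

/-- The identities hold for `ρ p` in `G` and descend by injectivity of `i`; continuity and the bound
descend because `i` is bounded below. -/
theorem IsBartleGraves.exists_factorSystem [CompleteSpace E] {X : Extension 𝕜 F E}
    {p : HomogeneousMap 𝕜 F X.G} (hp : IsBartleGraves X p) :
    ∃ φ : FactorSystem 𝕜 F E, ∀ x y, X.i (φ x y) = rho 𝕜 F X.G p x y := by
  have hker : ∀ x y, X.σ (rhoFun p x y) = 0 := fun x y => by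
    simp only [rhoFun, map_sub, hp _]
    abel
  choose f hf using fun x y => (X.exact (rhoFun p x y)).1 (hker x y)
  have hr := rhoFun_mem p
  obtain ⟨c, hc⟩ := X.exists_antilipschitz
  refine ⟨⟨f, ?_⟩, hf⟩
  exact
  { continuous := by
      rw [X.isInducing_i.continuous_iff]
      exact hr.continuous.congr fun z => (hf z.1 z.2).symm
    smul := fun a x y => X.injective (by rw [hf, map_smul, hf, hr.smul])
    symm := fun x y => X.injective (by rw [hf, hf, hr.symm])
    zero := fun x => X.injective (by rw [hf, map_zero, hr.zero])
    cocycle := fun x y z => X.injective (by simp only [map_add, hf, hr.cocycle])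
    bound := by
      obtain ⟨D, hD0, hD⟩ := hr.bound
      refine ⟨c * D, by positivity, fun n x => ?_⟩
      have h1 : X.i (iterSum f n x) = iterSum (rhoFun p) n x := by
        simp [iterSum, map_sum, hf]
      calc ‖iterSum f n x‖ ≤ c * ‖X.i (iterSum f n x)‖ := hc.le_mul_norm (map_zero X.i) _
        _ ≤ c * (D * ∑ i ∈ Finset.range (n + 1), ‖x i‖) := by
          rw [h1]
          exact mul_le_mul_of_nonneg_left (hD n x) c.2
        _ = _ := by ring }

theorem Extension.exists_represents [CompleteSpace F] [CompleteSpace E] (X : Extension 𝕜 F E) :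
    ∃ φ, Represents X φ := by
  obtain ⟨p, hp⟩ := X.exists_isBartleGraves
  obtain ⟨φ, hφ⟩ := hp.exists_factorSystem
  exact ⟨φ, p, hp, hφ⟩

/-- A morphism of extensions over `T : E → E'` and `S : F → F'` identifies `T ∘ φ` with
`ψ ∘ (S × S)` in the cokernel. -/
theorem Represents.map_eq_map [CompleteSpace E'] {X : Extension 𝕜 F E} {Y : Extension 𝕜 F' E'}
    {φ : FactorSystem 𝕜 F E} {ψ : FactorSystem 𝕜 F' E'} (hφ : Represents X φ)
    (hψ : Represents Y ψ) (T : E →L[𝕜] E') (S : F →L[𝕜] F') (h : X.G →L[𝕜] Y.G)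
    (hi : ∀ e, h (X.i e) = Y.i (T e)) (hσ : ∀ g, Y.σ (h g) = S (X.σ g)) :
    (LinearMap.range (rho 𝕜 F E')).mkQ (FactorSystem.map T (ContinuousLinearMap.id 𝕜 F) φ) =
      (LinearMap.range (rho 𝕜 F E')).mkQ (FactorSystem.map (ContinuousLinearMap.id 𝕜 E') S ψ) := by
  obtain ⟨p, hp, hφ⟩ := hφ
  obtain ⟨q, hq, hψ⟩ := hψ
  -- Both `h p` and `q S` lift `S` through `Y.σ`, so their difference is `Y.i k`, and `ρ k` is the
  -- difference of the two factor systems.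
  obtain ⟨k, hk⟩ := Y.exists_homogeneousMap_of_σ_eq_zero
    (HomogeneousMap.map h (ContinuousLinearMap.id 𝕜 F) p -
      HomogeneousMap.map (ContinuousLinearMap.id 𝕜 Y.G) S q) (fun x => by
        change Y.σ (h (p x) - q (S x)) = 0
        rw [map_sub, hσ, hp, hq, sub_self])
  refine (Submodule.Quotient.eq _).2 ⟨k, Subtype.ext (funext fun x => funext fun y => ?_)⟩
  refine Y.injective ?_
  change Y.i (k (x + y) - k x - k y) = Y.i (T (φ x y) - ψ (S x) (S y))
  have hk' : ∀ x, Y.i (k x) = h (p x) - q (S x) := hk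
  have hφ' : ∀ x y, X.i (φ x y) = p (x + y) - p x - p y := hφ
  have hψ' : ∀ x y, Y.i (ψ x y) = q (x + y) - q x - q y := hψ
  simp only [map_sub, ← hi, hφ', hψ', hk', map_add]
  abel

theorem Represents.eq_of_congruent [CompleteSpace E] {X Y : Extension 𝕜 F E}
    {φ ψ : FactorSystem 𝕜 F E} (hφ : Represents X φ) (hψ : Represents Y ψ) (h : Congruent X Y) :
    (LinearMap.range (rho 𝕜 F E)).mkQ φ = (LinearMap.range (rho 𝕜 F E)).mkQ ψ := by
  obtain ⟨h, hi, hσ⟩ := h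
  exact hφ.map_eq_map hψ (ContinuousLinearMap.id 𝕜 E) (ContinuousLinearMap.id 𝕜 F) h hi hσ

/-- Changing the section by `i k` changes the factor system by `ρ k`, so every member of the class
is represented. -/
theorem Represents.add_rho {X : Extension 𝕜 F E} {φ : FactorSystem 𝕜 F E}
    (hφ : Represents X φ) (k : HomogeneousMap 𝕜 F E) : Represents X (φ + rho 𝕜 F E k) := by
  obtain ⟨p, hp, hφ⟩ := hφ
  refine ⟨p + HomogeneousMap.map X.i (ContinuousLinearMap.id 𝕜 F) k, fun y => ?_, fun x y => ?_⟩
  · change X.σ (p y + X.i (k y)) = y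
    rw [map_add, hp, X.exact.apply_apply_eq_zero, add_zero]
  · change X.i (φ x y + (k (x + y) - k x - k y)) =
      (p (x + y) + X.i (k (x + y))) - (p x + X.i (k x)) - (p y + X.i (k y))
    have hφ' : X.i (φ x y) = p (x + y) - p x - p y := hφ x y
    rw [map_add, hφ', map_sub, map_sub]
    abel

theorem Represents.congruent [CompleteSpace E] {X Y : Extension 𝕜 F E} {φ : FactorSystem 𝕜 F E}
    (hX : Represents X φ) (hY : Represents Y φ) : Congruent X Y := by
  obtain ⟨p, hp, hpφ⟩ := hX
  obtain ⟨q, hq, hqφ⟩ := hY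
  have hp' : ∀ x y, X.i (φ x y) = p (x + y) - p x - p y := hpφ
  have hq' : ∀ x y, Y.i (φ x y) = q (x + y) - q x - q y := hqφ
  have hker : ∀ g, X.σ (g - p (X.σ g)) = 0 := fun g => by rw [map_sub, hp, sub_self]
  -- The nonlinear retraction `r` and `σ` are coordinates on `X.G`; `r` fails to be additive by
  -- `-φ`.
  choose r hr using fun g => (X.exact (g - p (X.σ g))).1 (hker g)
  have hrcont : Continuous r := by
    rw [X.isInducing_i.continuous_iff]
    exact (continuous_id.sub (p.2.1.comp X.σ.continuous)).congr fun g => (hr g).symm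
  have hradd : ∀ g g', r (g + g') = r g + r g' - φ (X.σ g) (X.σ g') := fun g g' =>
    X.injective (by simp only [hr, map_sub, map_add, hp']; abel)
  have hrsmul : ∀ (c : 𝕜) g, r (c • g) = c • r g := fun c g =>
    X.injective (by simp only [hr, map_smul, p.map_smul', smul_sub])
  have hri : ∀ e, r (X.i e) = e := fun e =>
    X.injective (by rw [hr, X.exact.apply_apply_eq_zero, p.map_zero', sub_zero])
  -- The defect `-φ` of `r` cancels the defect `+φ` of `q`, so the sum is linear.
  let f : X.G →L[𝕜] Y.G :=
    { toFun := fun g => Y.i (r g) + q (X.σ g)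
      map_add' := fun g g' => by
        simp only [hradd, map_sub, map_add, hq']
        abel
      map_smul' := fun c g => by
        simp only [hrsmul, map_smul, q.map_smul', smul_add, RingHom.id_apply]
      cont := (Y.i.continuous.comp hrcont).add (q.2.1.comp X.σ.continuous) }
  refine Congruent.of_map f (fun e => ?_) fun g => ?_
  · change Y.i (r (X.i e)) + q (X.σ (X.i e)) = Y.i e
    rw [hri, X.exact.apply_apply_eq_zero, q.map_zero', add_zero]
  · change Y.σ (Y.i (r g) + q (X.σ g)) = X.σ g
    rw [map_add, Y.exact.apply_apply_eq_zero, hq, zero_add]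

theorem Represents.congruent_of_eq [CompleteSpace E] {X Y : Extension 𝕜 F E}
    {φ ψ : FactorSystem 𝕜 F E} (hX : Represents X φ) (hY : Represents Y ψ)
    (h : (LinearMap.range (rho 𝕜 F E)).mkQ φ = (LinearMap.range (rho 𝕜 F E)).mkQ ψ) :
    Congruent X Y := by
  obtain ⟨k, hk⟩ := (Submodule.Quotient.eq _).1 h
  have h1 := hY.add_rho k
  rw [hk, add_sub_cancel] at h1
  exact hX.congruent h1

/-- The direct sum of the Bartle-Graves maps of two extensions. -/
theorem Represents.exists_directSum [CompleteSpace E] [CompleteSpace E']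
    {X : Extension 𝕜 F E} {Y : Extension 𝕜 F' E'} {φ : FactorSystem 𝕜 F E}
    {ψ : FactorSystem 𝕜 F' E'} (hφ : Represents X φ) (hψ : Represents Y ψ) :
    ∃ θ : FactorSystem 𝕜 (F × F') (E × E'), Represents (X.directSum Y) θ ∧
      ∀ x y, θ x y = (φ x.1 y.1, ψ x.2 y.2) := by
  obtain ⟨p, hp, hpφ⟩ := hφ
  obtain ⟨q, hq, hqψ⟩ := hψ
  let s : HomogeneousMap 𝕜 (F × F') (X.G × Y.G) :=
    HomogeneousMap.map (ContinuousLinearMap.inl 𝕜 X.G Y.G) (ContinuousLinearMap.fst 𝕜 F F') p +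
    HomogeneousMap.map (ContinuousLinearMap.inr 𝕜 X.G Y.G) (ContinuousLinearMap.snd 𝕜 F F') q
  have hs : ∀ z, s z = (p z.1, q z.2) := fun z => by
    change (p z.1, (0 : Y.G)) + ((0 : X.G), q z.2) = _
    simp
  have hBG : IsBartleGraves (X.directSum Y) s := fun z => by
    change (X.σ (s z).1, Y.σ (s z).2) = z
    rw [hs, hp, hq]
  obtain ⟨θ, hθ⟩ := hBG.exists_factorSystem
  refine ⟨θ, ⟨s, hBG, hθ⟩, fun x y => (X.directSum Y).injective ((hθ x y).trans ?_)⟩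
  change s (x + y) - s x - s y = (X.i (φ x.1 y.1), Y.i (ψ x.2 y.2))
  rw [hs, hs, hs, hpφ, hqψ]
  rfl

end Representation

/-! ### The vector space structure of the twisted sum. -/

section TwistedSum

variable {𝕜 : Type v} [RCLike 𝕜] {F E : Type u}
  [NormedAddCommGroup F] [NormedSpace 𝕜 F] [NormedAddCommGroup E] [NormedSpace 𝕜 E]

theorem FactorSystem.apply_zero (φ : FactorSystem 𝕜 F E) (x : F) : φ x 0 = 0 := φ.2.zero x

theorem FactorSystem.zero_apply (φ : FactorSystem 𝕜 F E) (x : F) : φ 0 x = 0 := by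
  rw [φ.2.symm, φ.apply_zero]

theorem FactorSystem.apply_comm (φ : FactorSystem 𝕜 F E) (x y : F) : φ x y = φ y x := φ.2.symm x y

theorem FactorSystem.map_smul_smul (φ : FactorSystem 𝕜 F E) (c : 𝕜) (x y : F) :
    φ (c • x) (c • y) = c • φ x y := φ.2.smul c x y

/-- Homogeneity for `-1` and symmetry give `φ (-x, x) = -φ (-x, x)`. This makes the componentwise
negative an inverse. -/
theorem FactorSystem.apply_neg_self (φ : FactorSystem 𝕜 F E) (x : F) : φ (-x) x = 0 := by
  have h := φ.map_smul_smul (-1) x (-x)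
  rw [neg_one_smul, neg_one_smul, neg_neg, neg_one_smul, φ.apply_comm x (-x)] at h
  have h2 : (2 : 𝕜) • φ (-x) x = 0 := by rw [two_smul, ← sub_neg_eq_add, ← h, sub_self]
  exact (smul_eq_zero.1 h2).resolve_left two_ne_zero

/-- The space `E × F` with the addition twisted by the factor system `φ`. -/
@[ext]
structure TwistedSum (φ : FactorSystem 𝕜 F E) : Type u where
  /-- The component in the subspace. -/
  fst : E
  /-- The component in the quotient. -/
  snd : F

namespace TwistedSum

variable {φ : FactorSystem 𝕜 F E}

instance : Zero (TwistedSum φ) := ⟨⟨0, 0⟩⟩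

instance : Add (TwistedSum φ) := ⟨fun z w => ⟨z.fst + w.fst - φ z.snd w.snd, z.snd + w.snd⟩⟩

instance : Neg (TwistedSum φ) := ⟨fun z => ⟨-z.fst, -z.snd⟩⟩

instance : SMul 𝕜 (TwistedSum φ) := ⟨fun c z => ⟨c • z.fst, c • z.snd⟩⟩

@[simp] theorem fst_zero : (0 : TwistedSum φ).fst = 0 := rfl

@[simp] theorem snd_zero : (0 : TwistedSum φ).snd = 0 := rfl

@[simp] theorem fst_add (z w : TwistedSum φ) :
    (z + w).fst = z.fst + w.fst - φ z.snd w.snd := rfl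

@[simp] theorem snd_add (z w : TwistedSum φ) : (z + w).snd = z.snd + w.snd := rfl

@[simp] theorem fst_neg (z : TwistedSum φ) : (-z).fst = -z.fst := rfl

@[simp] theorem snd_neg (z : TwistedSum φ) : (-z).snd = -z.snd := rfl

@[simp] theorem fst_smul (c : 𝕜) (z : TwistedSum φ) : (c • z).fst = c • z.fst := rfl

@[simp] theorem snd_smul (c : 𝕜) (z : TwistedSum φ) : (c • z).snd = c • z.snd := rfl

instance : AddCommGroup (TwistedSum φ) where
  add_assoc a b c := by
    refine TwistedSum.ext ?_ (add_assoc _ _ _)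
    have h : φ a.snd b.snd + φ (a.snd + b.snd) c.snd = φ b.snd c.snd + φ a.snd (b.snd + c.snd) :=
      φ.2.cocycle _ _ _
    simp only [fst_add, snd_add]
    rw [sub_add_eq_add_sub, sub_sub, h]
    abel
  zero_add a := TwistedSum.ext (by simp [φ.zero_apply]) (by simp)
  add_zero a := TwistedSum.ext (by simp [φ.apply_zero]) (by simp)
  nsmul := nsmulRec
  zsmul := zsmulRec
  neg_add_cancel a := TwistedSum.ext (by simp [φ.apply_neg_self]) (by simp)
  add_comm a b := TwistedSum.ext (by simp [φ.apply_comm a.snd, add_comm]) (by simp [add_comm])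

theorem sub_eq (z w : TwistedSum φ) :
    z - w = ⟨z.fst - w.fst - φ z.snd (-w.snd), z.snd - w.snd⟩ := by
  rw [sub_eq_add_neg]
  exact TwistedSum.ext (by simp [sub_eq_add_neg]) (by simp [sub_eq_add_neg])

instance : DistribMulAction 𝕜 (TwistedSum φ) where
  one_smul z := TwistedSum.ext (one_smul _ _) (one_smul _ _)
  mul_smul c d z := TwistedSum.ext (mul_smul _ _ _) (mul_smul _ _ _)
  smul_zero c := TwistedSum.ext (smul_zero _) (smul_zero _)
  smul_add c z w := TwistedSum.ext
    (by simp [φ.map_smul_smul, smul_sub]) (smul_add _ _ _)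

/-- Projection to the quotient, as a homomorphism. -/
def sndHom : TwistedSum φ →+ F := ⟨⟨snd, rfl⟩, fun _ _ => rfl⟩

@[simp] theorem snd_sum {ι : Type*} (s : Finset ι) (f : ι → TwistedSum φ) :
    (∑ i ∈ s, f i).snd = ∑ i ∈ s, (f i).snd := map_sum sndHom f s

/-- The embedding of the subspace, as a homomorphism. -/
def inlHom : E →+ TwistedSum φ :=
  ⟨⟨fun x => ⟨x, 0⟩, rfl⟩, fun _ _ => TwistedSum.ext (by simp [φ.apply_zero]) (by simp)⟩

theorem eq_add (z : TwistedSum φ) : z = inlHom z.fst + ⟨0, z.snd⟩ :=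
  TwistedSum.ext (by simp [inlHom, φ.zero_apply]) (by simp [inlHom])

/-- The bound in the definition of a factor system is exactly a bound on the first component of such
sums. -/
theorem sum_range_mk_zero (n : ℕ) (x : ℕ → F) :
    ∑ i ∈ Finset.range (n + 1), (⟨0, x i⟩ : TwistedSum φ) =
      ⟨-iterSum φ n x, ∑ i ∈ Finset.range (n + 1), x i⟩ := by
  induction n with
  | zero => simp [iterSum]
  | succ n ih =>
    rw [Finset.sum_range_succ, ih]
    refine TwistedSum.ext ?_ ?_
    · have h : iterSum φ (n + 1) x =
          iterSum φ n x + φ (∑ i ∈ Finset.range (n + 1), x i) (x (n + 1)) :=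
        Finset.sum_range_succ _ _
      simp only [fst_add, h]
      abel
    · simp only [snd_add]
      rw [Finset.sum_range_succ _ (n + 1)]

theorem norm_fst_sum_range_le (n : ℕ) (x : ℕ → F) :
    ‖(∑ i ∈ Finset.range n, (⟨0, x i⟩ : TwistedSum φ)).fst‖ ≤
      ‖φ‖ * ∑ i ∈ Finset.range n, ‖x i‖ := by
  cases n with
  | zero => simp
  | succ n =>
    rw [sum_range_mk_zero, norm_neg]
    exact (FactorSystem.isBoundFor_norm φ).2 n x

theorem norm_fst_sum_mk_zero_le {ι : Type*} (s : Finset ι) (f : ι → F) :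
    ‖(∑ i ∈ s, (⟨0, f i⟩ : TwistedSum φ)).fst‖ ≤ ‖φ‖ * ∑ i ∈ s, ‖f i‖ := by
  classical
  -- The default value 0 is never reached: only indices below `s.card` are summed.
  let x : ℕ → F := fun j => if h : j < s.card then f (s.equivFin.symm ⟨j, h⟩) else 0
  have h1 : ∑ i ∈ s, (⟨0, f i⟩ : TwistedSum φ) = ∑ j ∈ Finset.range s.card, ⟨0, x j⟩ := by
    rw [← Finset.sum_coe_sort, ← s.equivFin.symm.sum_comp, Finset.sum_fin_eq_sum_range]
    refine Finset.sum_congr rfl fun j _ => ?_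
    by_cases h : j < s.card
    · simp only [x, h, dif_pos]
    · simp only [x, h, dif_neg, not_false_eq_true]
      rfl
  rw [h1]
  refine (norm_fst_sum_range_le _ x).trans_eq ?_
  have h2 : ∑ i ∈ s, ‖f i‖ = ∑ j ∈ Finset.range s.card, ‖x j‖ := by
    rw [← Finset.sum_coe_sort, ← s.equivFin.symm.sum_comp, Finset.sum_fin_eq_sum_range]
    refine Finset.sum_congr rfl fun j _ => ?_
    by_cases h : j < s.card <;> simp [x, h]
  rw [h2]

theorem norm_fst_sum_le {ι : Type*} (s : Finset ι) (f : ι → TwistedSum φ) :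
    ‖(∑ i ∈ s, f i).fst‖ ≤ ∑ i ∈ s, ‖(f i).fst‖ + ‖φ‖ * ∑ i ∈ s, ‖(f i).snd‖ := by
  have h : ∑ i ∈ s, f i =
      inlHom (∑ i ∈ s, (f i).fst) + ∑ i ∈ s, (⟨0, (f i).snd⟩ : TwistedSum φ) := by
    rw [map_sum, ← Finset.sum_add_distrib]
    exact Finset.sum_congr rfl fun i _ => eq_add _
  rw [h, fst_add]
  simp only [inlHom, AddMonoidHom.coe_mk, ZeroHom.coe_mk, φ.zero_apply, sub_zero]
  exact (norm_add_le _ _).trans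
    (add_le_add (norm_sum_le _ _) (norm_fst_sum_mk_zero_le s fun i => (f i).snd))

/-- An additive map that agrees with the multiplication by `a` up to a defect in the subspace
agrees with it if its iterates do not grow faster than the powers of `a`. -/
theorem eq_smul_of_norm_iterate_le (a : 𝕜) (L : TwistedSum φ →+ TwistedSum φ)
    (hcomm : ∀ z, L (a • z) = a • L z) (hfst : ∀ x, L ⟨x, 0⟩ = ⟨a • x, 0⟩)
    (hsnd : ∀ z, (L z).snd = a • z.snd)
    (hbound : ∀ z, ∃ B : ℝ, ∀ n : ℕ, ‖(L^[n] z).fst‖ ≤ B * ‖a‖ ^ n) (z : TwistedSum φ) :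
    L z = a • z := by
  let d : E := (a • z).fst - (L z).fst
  have hd : L z = a • z - ⟨d, 0⟩ := by
    rw [sub_eq]
    exact TwistedSum.ext (by simp [d, φ.apply_zero]) (by simp [hsnd])
  have hcomm' : ∀ n w, L ((a ^ n) • w) = (a ^ n) • L w := by
    intro n
    induction n with
    | zero => simp
    | succ n ih => intro w; rw [pow_succ', mul_smul, hcomm, ih, ← mul_smul]
  -- As for a Jordan block, the defect accumulates a factor `n + 1` beside the power of `a`.
  have hiter : ∀ n : ℕ, L^[n + 1] z = (a ^ (n + 1)) • z - ⟨((n + 1 : ℕ) : 𝕜) • a ^ n • d, 0⟩ := by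
    intro n
    induction n with
    | zero => simpa using hd
    | succ n ih =>
      rw [Function.iterate_succ_apply', ih, map_sub, hcomm', hd, hfst, smul_sub, ← mul_smul,
        ← pow_succ, sub_sub]
      congr 1
      refine TwistedSum.ext ?_ (by simp)
      simp only [fst_add, fst_smul, snd_smul, smul_zero, φ.apply_zero, sub_zero]
      rw [smul_comm a, smul_smul a, ← pow_succ']
      push_cast
      module
  obtain ⟨B, hB⟩ := hbound z
  have hle : ∀ n : ℕ, ((n : ℝ) + 1) * ‖a‖ ^ n * ‖d‖ ≤ (‖z.fst‖ + B) * ‖a‖ ^ (n + 1) := by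
    intro n
    have h1 : ((n + 1 : ℕ) : 𝕜) • a ^ n • d = (a ^ (n + 1)) • z.fst - (L^[n + 1] z).fst := by
      rw [hiter, sub_eq]
      simp [φ.apply_zero]
    have h2 : ‖((n + 1 : ℕ) : 𝕜) • a ^ n • d‖ = ((n : ℝ) + 1) * ‖a‖ ^ n * ‖d‖ := by
      rw [norm_smul, norm_smul, norm_pow, RCLike.norm_natCast, mul_assoc]
      push_cast
      rfl
    rw [← h2, h1]
    refine (norm_sub_le _ _).trans ?_
    rw [norm_smul, norm_pow, add_mul, mul_comm ‖z.fst‖]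
    exact add_le_add le_rfl (hB _)
  have hd0 : d = 0 := by
    rw [← norm_le_zero_iff]
    rcases (norm_nonneg a).eq_or_lt with ha | ha
    -- For `a = 0` the first iterate suffices, since `‖a‖ ^ 0 = 1` on the left and `‖a‖ ^ 1 = 0` on
    -- the right.
    · simpa [← ha] using hle 0
    · by_contra hpos
      rw [not_le] at hpos
      obtain ⟨n, hn⟩ := exists_nat_gt ((‖z.fst‖ + B) * ‖a‖ / ‖d‖)
      rw [div_lt_iff₀ hpos] at hn
      have h1 := hle n
      have h2 : ((n : ℝ) + 1) * ‖d‖ ≤ (‖z.fst‖ + B) * ‖a‖ := by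
        refine le_of_mul_le_mul_right ?_ (pow_pos ha n)
        calc _ = ((n : ℝ) + 1) * ‖a‖ ^ n * ‖d‖ := by ring
          _ ≤ _ := h1
          _ = _ := by ring
      linarith
  rw [hd, hd0]
  exact sub_zero (a • z)

theorem norm_fst_nsmul_le (n : ℕ) (z : TwistedSum φ) :
    ‖(n • z).fst‖ ≤ (‖z.fst‖ + ‖φ‖ * ‖z.snd‖) * n := by
  have h := norm_fst_sum_le (Finset.range n) fun _ => z
  simp only [Finset.sum_const, Finset.card_range, nsmul_eq_mul] at h
  exact h.trans_eq (by ring)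

/-- Iterating the `n`-fold sum gives `n ^ k`-fold sums, whose first components grow at most like `n
^ k`; hence there is no defect. -/
theorem natCast_smul_eq (n : ℕ) (z : TwistedSum φ) : (n : 𝕜) • z = n • z := by
  have hiter : ∀ k w, (nsmulAddMonoidHom (α := TwistedSum φ) n)^[k] w = n ^ k • w := by
    intro k
    induction k with
    | zero => simp
    | succ k ih =>
      intro w
      rw [Function.iterate_succ_apply', ih, nsmulAddMonoidHom_apply, pow_succ', mul_smul]
  refine (eq_smul_of_norm_iterate_le (n : 𝕜) (nsmulAddMonoidHom n) (fun w => ?_) (fun x => ?_)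
    (fun w => ?_) (fun w => ⟨‖w.fst‖ + ‖φ‖ * ‖w.snd‖, fun k => ?_⟩) z).symm
  · exact (map_nsmul (DistribSMul.toAddMonoidHom (TwistedSum φ) (n : 𝕜)) n w).symm
  · change n • inlHom x = inlHom ((n : 𝕜) • x)
    rw [← map_nsmul, Nat.cast_smul_eq_nsmul]
  · change sndHom (n • w) = (n : 𝕜) • sndHom w
    rw [map_nsmul, Nat.cast_smul_eq_nsmul]
  · rw [hiter, RCLike.norm_natCast]
    exact_mod_cast norm_fst_nsmul_le (n ^ k) w

theorem intCast_smul_eq (n : ℤ) (z : TwistedSum φ) : (n : 𝕜) • z = n • z := by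
  have hneg : ∀ (c : 𝕜) (w : TwistedSum φ), (-c) • w = -(c • w) := fun c w =>
    TwistedSum.ext (neg_smul _ _) (neg_smul _ _)
  obtain ⟨m, rfl | rfl⟩ := n.eq_nat_or_neg
  · rw [Int.cast_natCast, natCast_smul_eq, natCast_zsmul]
  · rw [Int.cast_neg, Int.cast_natCast, hneg, natCast_smul_eq, neg_zsmul, natCast_zsmul]

theorem _root_.BanachExt.FactorSystem.apply_intCast_smul (φ : FactorSystem 𝕜 F E) (m n : ℤ)
    (y : F) : φ ((m : 𝕜) • y) ((n : 𝕜) • y) = 0 := by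
  have h : ((m + n : ℤ) : 𝕜) • (⟨0, y⟩ : TwistedSum φ) =
      (m : 𝕜) • (⟨0, y⟩ : TwistedSum φ) + (n : 𝕜) • (⟨0, y⟩ : TwistedSum φ) := by
    simp only [intCast_smul_eq, add_zsmul]
  simpa using congrArg fst h

theorem _root_.BanachExt.FactorSystem.apply_ratCast_smul (φ : FactorSystem 𝕜 F E) (p q : ℚ)
    (y : F) : φ (((p : ℝ) : 𝕜) • y) (((q : ℝ) : 𝕜) • y) = 0 := by
  have hp : (p.den : 𝕜) ≠ 0 := Nat.cast_ne_zero.2 p.den_ne_zero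
  have hq : (q.den : 𝕜) ≠ 0 := Nat.cast_ne_zero.2 q.den_ne_zero
  -- With the common denominator absorbed into the vector, both multiples become integral.
  have h := φ.apply_intCast_smul (p.num * q.den) (q.num * p.den)
    (((p.den : 𝕜) * (q.den : 𝕜))⁻¹ • y)
  rw [smul_smul, smul_smul] at h
  have h1 : ((p.num * q.den : ℤ) : 𝕜) * ((p.den : 𝕜) * (q.den : 𝕜))⁻¹ = ((p : ℝ) : 𝕜) := by
    rw [RCLike.ofReal_ratCast, Rat.cast_def]
    push_cast
    field_simp
  have h2 : ((q.num * p.den : ℤ) : 𝕜) * ((p.den : 𝕜) * (q.den : 𝕜))⁻¹ = ((q : ℝ) : 𝕜) := by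
    rw [RCLike.ofReal_ratCast, Rat.cast_def]
    push_cast
    field_simp
  rwa [h1, h2] at h

theorem _root_.BanachExt.FactorSystem.apply_ofReal_smul (φ : FactorSystem 𝕜 F E) (a b : ℝ)
    (y : F) : φ ((a : 𝕜) • y) ((b : 𝕜) • y) = 0 := by
  refine Rat.denseRange_cast.induction_on₂ (p := fun a b : ℝ => φ ((a : 𝕜) • y) ((b : 𝕜) • y) = 0)
    ?_ (fun p q => φ.apply_ratCast_smul p q y) a b
  refine isClosed_eq (φ.2.continuous.comp (f := fun q : ℝ × ℝ => (((q.1 : 𝕜) • y), ((q.2 : 𝕜) • y)))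
    ?_) continuous_const
  exact ((RCLike.continuous_ofReal.comp continuous_fst).smul continuous_const).prodMk
    ((RCLike.continuous_ofReal.comp continuous_snd).smul continuous_const)

theorem ofReal_add_smul (a b : ℝ) (z : TwistedSum φ) :
    ((a : 𝕜) + (b : 𝕜)) • z = (a : 𝕜) • z + (b : 𝕜) • z :=
  TwistedSum.ext (by simp [φ.apply_ofReal_smul, add_smul]) (add_smul _ _ _)

/-- The map `z ↦ re a • z + (im a * I) • z`. -/
def reIm (a : 𝕜) : TwistedSum φ →+ TwistedSum φ :=
  DistribSMul.toAddMonoidHom (TwistedSum φ) (RCLike.re a : 𝕜) +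
    DistribSMul.toAddMonoidHom (TwistedSum φ) ((RCLike.im a : 𝕜) * RCLike.I)

theorem reIm_apply (a : 𝕜) (z : TwistedSum φ) :
    reIm a z = (RCLike.re a : 𝕜) • z + ((RCLike.im a : 𝕜) * RCLike.I) • z := rfl

theorem reIm_smul (a c : 𝕜) (z : TwistedSum φ) : reIm a (c • z) = c • reIm a z := by
  simp only [reIm_apply, smul_add, smul_smul, mul_comm c]

theorem reIm_add (a b : 𝕜) (z : TwistedSum φ) : reIm (a + b) z = reIm a z + reIm b z := by
  simp only [reIm_apply, map_add, mul_smul, ofReal_add_smul]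
  abel

/-- Multiplicativity turns iterates of `reIm a` into `reIm (a ^ n)`, as the growth argument needs.
If `I = 0`, `reIm a` is just multiplication by `a`; otherwise the products are expanded with `I ^ 2
= -1`. -/
theorem reIm_mul (a b : 𝕜) (z : TwistedSum φ) : reIm (a * b) z = reIm a (reIm b z) := by
  rcases RCLike.I_mul_I (K := 𝕜) with hI | hI
  · have him : ∀ c : 𝕜, ((RCLike.re c : ℝ) : 𝕜) = c := fun c => by
      simpa [hI] using RCLike.re_add_im c
    have h0 : ∀ w : TwistedSum φ, (0 : 𝕜) • w = 0 := fun w =>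
      TwistedSum.ext (zero_smul _ _) (zero_smul _ _)
    simp only [reIm_apply, him, hI, mul_zero, h0, add_zero, mul_smul]
  · have hneg : ∀ (c : 𝕜) (w : TwistedSum φ), (-c) • w = -(c • w) := fun c w =>
      TwistedSum.ext (neg_smul _ _) (neg_smul _ _)
    have hII : ∀ c d : ℝ, ((c : 𝕜) * RCLike.I) • ((d : 𝕜) * RCLike.I) • z =
        -(((c * d : ℝ) : 𝕜) • z) := fun c d => by
      rw [smul_smul, ← hneg, mul_mul_mul_comm, hI]
      push_cast
      rw [mul_neg_one]
    simp only [reIm_apply, smul_add, hII, RCLike.mul_re, RCLike.mul_im]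
    rw [sub_eq_add_neg, RCLike.ofReal_add, ofReal_add_smul, RCLike.ofReal_neg, hneg, mul_smul,
      RCLike.ofReal_add, ofReal_add_smul]
    simp only [smul_smul]
    push_cast
    rw [mul_right_comm (RCLike.im a : 𝕜), mul_assoc (RCLike.re a : 𝕜)]
    abel

theorem norm_fst_reIm_le (a : 𝕜) (z : TwistedSum φ) :
    ‖(reIm a z).fst‖ ≤ (2 * ‖z.fst‖ + ‖φ‖ * (2 * ‖z.snd‖)) * ‖a‖ := by
  have h1 : ‖((RCLike.re a : ℝ) : 𝕜)‖ ≤ ‖a‖ := by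
    simpa using RCLike.abs_re_le_norm a
  have h2 : ‖((RCLike.im a : ℝ) : 𝕜) * RCLike.I‖ ≤ ‖a‖ := by
    rw [norm_mul, RCLike.norm_ofReal]
    have hI : ‖(RCLike.I : 𝕜)‖ ≤ 1 := by
      rw [RCLike.norm_I]
      split_ifs <;> norm_num
    exact (mul_le_of_le_one_right (abs_nonneg _) hI).trans
      (RCLike.abs_im_le_norm a)
  rw [reIm_apply, fst_add]
  have h3 := (FactorSystem.isBoundFor_norm φ).norm_apply_le
    ((RCLike.re a : 𝕜) • z.snd) (((RCLike.im a : 𝕜) * RCLike.I) • z.snd)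
  have h4 : ‖φ‖ * (‖(RCLike.re a : 𝕜) • z.snd‖ + ‖((RCLike.im a : 𝕜) * RCLike.I) • z.snd‖) ≤
      ‖φ‖ * (‖a‖ * ‖z.snd‖ + ‖a‖ * ‖z.snd‖) := by
    rw [norm_smul, norm_smul]
    gcongr
  have h5 : ‖(RCLike.re a : 𝕜) • z.fst‖ + ‖((RCLike.im a : 𝕜) * RCLike.I) • z.fst‖ ≤
      ‖a‖ * ‖z.fst‖ + ‖a‖ * ‖z.fst‖ := by
    rw [norm_smul, norm_smul]
    gcongr
  refine (norm_sub_le _ _).trans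
    ((add_le_add ((norm_add_le _ _).trans h5) (h3.trans h4)).trans_eq ?_)
  ring

/-- The map `reIm a` is additive in `a` by the real case, so this identification yields
distributivity for all scalars. -/
theorem reIm_eq_smul (a : 𝕜) (z : TwistedSum φ) : reIm a z = a • z := by
  have hiter : ∀ n (w : TwistedSum φ), (reIm a)^[n] w = reIm (a ^ n) w := by
    intro n
    induction n with
    | zero => intro w; simp [reIm_apply, TwistedSum.ext_iff]
    | succ n ih => intro w; rw [Function.iterate_succ_apply', ih, pow_succ', reIm_mul]
  refine eq_smul_of_norm_iterate_le a (reIm a) (reIm_smul a a) (fun x => ?_) (fun w => ?_)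
    (fun w => ⟨2 * ‖w.fst‖ + ‖φ‖ * (2 * ‖w.snd‖), fun n => ?_⟩) z
  · refine TwistedSum.ext ?_ (by simp [reIm_apply])
    simp [reIm_apply, φ.apply_zero, ← add_smul, RCLike.re_add_im]
  · simp [reIm_apply, ← add_smul, RCLike.re_add_im]
  · rw [hiter, ← norm_pow]
    exact norm_fst_reIm_le _ _

instance : Module 𝕜 (TwistedSum φ) where
  add_smul a b z := by simp only [← reIm_eq_smul, reIm_add]
  zero_smul z := TwistedSum.ext (zero_smul _ _) (zero_smul _ _)

end TwistedSum

end TwistedSum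

/-! ### The gauge norm and completeness of the twisted sum. -/

section TwistedSumNorm

variable {𝕜 : Type v} [RCLike 𝕜] {F E : Type u}
  [NormedAddCommGroup F] [NormedSpace 𝕜 F] [NormedAddCommGroup E] [NormedSpace 𝕜 E]
  {φ : FactorSystem 𝕜 F E}

namespace TwistedSum

variable (φ) in
/-- The underlying set of the twisted sum is `E × F`. -/
def equiv : E × F ≃ TwistedSum φ where
  toFun z := ⟨z.1, z.2⟩
  invFun z := (z.fst, z.snd)
  left_inv _ := rfl
  right_inv _ := rfl

/-- The real structure of the twisted sum. -/
instance realModule : Module ℝ (TwistedSum φ) :=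
  Module.compHom (TwistedSum φ) (algebraMap ℝ 𝕜)

instance : IsScalarTower ℝ 𝕜 (TwistedSum φ) where
  smul_assoc r c z := by
    rw [RCLike.real_smul_eq_coe_mul, mul_smul]
    rfl

theorem fst_real_smul (r : ℝ) (z : TwistedSum φ) : (r • z).fst = (r : 𝕜) • z.fst := rfl

theorem snd_real_smul (r : ℝ) (z : TwistedSum φ) : (r • z).snd = (r : 𝕜) • z.snd := rfl

variable (φ) in
/-- The unit balls of the two summands. -/
def generators : Set (TwistedSum φ) :=
  equiv φ '' ({z | ‖z.1‖ ≤ 1 ∧ z.2 = 0} ∪ {z | z.1 = 0 ∧ ‖z.2‖ ≤ 1})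

theorem mem_generators {z : TwistedSum φ} :
    z ∈ generators φ ↔ (‖z.fst‖ ≤ 1 ∧ z.snd = 0) ∨ (z.fst = 0 ∧ ‖z.snd‖ ≤ 1) := by
  constructor
  · rintro ⟨w, hw, rfl⟩
    exact hw
  · intro h
    exact ⟨(z.fst, z.snd), h, rfl⟩

/-- The hull is taken over `ℝ`; balancedness over `𝕜` makes its gauge homogeneous for all scalars.
-/
theorem balanced_convexHull_generators : Balanced 𝕜 (convexHull ℝ (generators φ)) := by
  rintro a ha _ ⟨z, hz, rfl⟩
  let m : TwistedSum φ →ₗ[ℝ] TwistedSum φ :=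
    { toFun := fun w => a • w
      map_add' := smul_add a
      map_smul' := fun r w => smul_comm a (r : 𝕜) w }
  have hsub : convexHull ℝ (generators φ) ⊆ m ⁻¹' convexHull ℝ (generators φ) := by
    refine convexHull_min (fun w hw => subset_convexHull ℝ _ ?_)
      ((convex_convexHull ℝ _).is_linear_preimage m.isLinear)
    have hle : ∀ {V : Type u} [NormedAddCommGroup V] [NormedSpace 𝕜 V] (x : V), ‖x‖ ≤ 1 →
        ‖a • x‖ ≤ 1 := fun x hx => by
      rw [norm_smul]
      exact mul_le_one₀ ha (norm_nonneg _) hx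
    rw [mem_generators] at hw ⊢
    change (‖a • w.fst‖ ≤ 1 ∧ a • w.snd = 0) ∨ (a • w.fst = 0 ∧ ‖a • w.snd‖ ≤ 1)
    rcases hw with ⟨h1, h2⟩ | ⟨h1, h2⟩
    · exact Or.inl ⟨hle _ h1, by rw [h2, smul_zero]⟩
    · exact Or.inr ⟨by rw [h1, smul_zero], hle _ h2⟩
  exact hsub hz

theorem norm_inv_smul_le_one {V : Type*} [NormedAddCommGroup V] [NormedSpace 𝕜 V] {r : ℝ} {x : V}
    (h : ‖x‖ ≤ |r|) : ‖((r⁻¹ : ℝ) : 𝕜) • x‖ ≤ 1 := by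
  rw [norm_smul, RCLike.norm_ofReal, abs_inv]
  exact (mul_le_mul_of_nonneg_left h (by positivity)).trans (inv_mul_le_one)

theorem absorbent_convexHull_generators : Absorbent ℝ (convexHull ℝ (generators φ)) := by
  rw [absorbent_iff_inv_smul]
  intro z
  have hev : ∀ᶠ c : ℝ in Bornology.cobounded ℝ, 2 * (‖z.fst‖ + ‖z.snd‖) ≤ ‖c‖ :=
    tendsto_norm_cobounded_atTop.eventually (eventually_ge_atTop _)
  filter_upwards [hev] with c hc
  rw [Real.norm_eq_abs] at hc
  have hc2 : |c / 2| = |c| / 2 := by rw [abs_div, abs_two]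
  have h1 : (⟨(((c / 2)⁻¹ : ℝ) : 𝕜) • z.fst, 0⟩ : TwistedSum φ) ∈ convexHull ℝ (generators φ) :=
    subset_convexHull ℝ _ (mem_generators.2 (Or.inl
      ⟨norm_inv_smul_le_one (by rw [hc2]; linarith [norm_nonneg z.snd]), rfl⟩))
  have h2 : (⟨0, (((c / 2)⁻¹ : ℝ) : 𝕜) • z.snd⟩ : TwistedSum φ) ∈ convexHull ℝ (generators φ) :=
    subset_convexHull ℝ _ (mem_generators.2 (Or.inr
      ⟨rfl, norm_inv_smul_le_one (by rw [hc2]; linarith [norm_nonneg z.fst])⟩))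
  -- The point `c⁻¹ z` is the midpoint of two generators; no twist appears because one of the second
  -- components is 0.
  have h3 := convex_convexHull ℝ (generators φ) h1 h2 (a := 1 / 2) (b := 1 / 2) (by norm_num)
    (by norm_num) (by norm_num)
  have h4 : ((1 / 2 : ℝ) : 𝕜) * (((c / 2)⁻¹ : ℝ) : 𝕜) = ((c⁻¹ : ℝ) : 𝕜) := by
    rw [← RCLike.ofReal_mul]
    congr 1
    rw [inv_div]
    ring
  convert h3 using 1
  refine TwistedSum.ext ?_ ?_
  · rw [fst_add, fst_real_smul, fst_real_smul, fst_real_smul, snd_real_smul, smul_zero,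
      smul_zero, φ.zero_apply, smul_smul, h4, add_zero, sub_zero]
  · rw [snd_add, snd_real_smul, snd_real_smul, snd_real_smul, smul_zero, smul_smul, h4, zero_add]

/-- The weights sum to 1, so the bound on iterated sums gives `1 + ‖φ‖` regardless of the number of
terms. -/
theorem norm_le_of_mem_convexHull_generators {z : TwistedSum φ}
    (hz : z ∈ convexHull ℝ (generators φ)) : ‖z.fst‖ ≤ 1 + ‖φ‖ ∧ ‖z.snd‖ ≤ 1 := by
  obtain ⟨ι, hι, w, f, hw0, hw1, hf, rfl⟩ := mem_convexHull_iff_exists_fintype.1 hz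
  have h1 : ∀ i, ‖(w i • f i).fst‖ ≤ w i := fun i => by
    rw [fst_real_smul, norm_smul, RCLike.norm_ofReal, abs_of_nonneg (hw0 i)]
    refine mul_le_of_le_one_right (hw0 i) ?_
    rcases mem_generators.1 (hf i) with h | h
    · exact h.1
    · simp [h.1]
  have h2 : ∀ i, ‖(w i • f i).snd‖ ≤ w i := fun i => by
    rw [snd_real_smul, norm_smul, RCLike.norm_ofReal, abs_of_nonneg (hw0 i)]
    refine mul_le_of_le_one_right (hw0 i) ?_
    rcases mem_generators.1 (hf i) with h | h
    · simp [h.2]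
    · exact h.2
  have hs1 : ∑ i, ‖(w i • f i).fst‖ ≤ 1 := (Finset.sum_le_sum fun i _ => h1 i).trans hw1.le
  have hs2 : ∑ i, ‖(w i • f i).snd‖ ≤ 1 := (Finset.sum_le_sum fun i _ => h2 i).trans hw1.le
  refine ⟨(norm_fst_sum_le Finset.univ _).trans ?_, ?_⟩
  · refine add_le_add hs1 ?_
    exact mul_le_of_le_one_right (norm_nonneg φ) hs2
  · rw [snd_sum]
    exact (norm_sum_le _ _).trans hs2

/-- The norm of the twisted sum is the gauge of the convex hull of the unit balls of the
summands. -/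
noncomputable instance : Norm (TwistedSum φ) := ⟨gauge (convexHull ℝ (generators φ))⟩

theorem norm_components_le (z : TwistedSum φ) :
    ‖z.fst‖ ≤ (1 + ‖φ‖) * ‖z‖ ∧ ‖z.snd‖ ≤ ‖z‖ := by
  have key : ∀ a > ‖z‖, ‖z.fst‖ ≤ (1 + ‖φ‖) * a ∧ ‖z.snd‖ ≤ a := by
    intro a ha
    obtain ⟨b, hb0, hba, w, hw, rfl⟩ := exists_lt_of_gauge_lt absorbent_convexHull_generators ha
    obtain ⟨h1, h2⟩ := norm_le_of_mem_convexHull_generators hw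
    have hn := norm_nonneg φ
    constructor
    · change ‖(b : 𝕜) • w.fst‖ ≤ _
      rw [norm_smul, RCLike.norm_ofReal, abs_of_pos hb0, mul_comm]
      exact mul_le_mul h1 hba.le hb0.le (by positivity)
    · change ‖(b : 𝕜) • w.snd‖ ≤ _
      rw [norm_smul, RCLike.norm_ofReal, abs_of_pos hb0]
      exact (mul_le_of_le_one_right hb0.le h2).trans hba.le
  constructor
  · have hn : 0 < 1 + ‖φ‖ := by positivity
    rw [mul_comm, ← div_le_iff₀ hn]
    refine le_of_forall_gt_imp_ge_of_dense fun a ha => ?_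
    rw [div_le_iff₀ hn, mul_comm]
    exact (key a ha).1
  · exact le_of_forall_gt_imp_ge_of_dense fun a ha => (key a ha).2

theorem norm_le_of_eq_zero_or_eq_zero {r : ℝ} (hr : 0 ≤ r) {z : TwistedSum φ}
    (hz : z.fst = 0 ∧ ‖z.snd‖ ≤ r ∨ ‖z.fst‖ ≤ r ∧ z.snd = 0) : ‖z‖ ≤ r := by
  -- Scaling by `a > r` permits `r = 0`.
  have key : ∀ a > r, ‖z‖ ≤ a := by
    intro a ha
    have ha0 : 0 < a := hr.trans_lt ha
    refine gauge_le_of_mem ha0.le ((Set.mem_smul_set_iff_inv_smul_mem₀ ha0.ne' _ _).2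
      (subset_convexHull ℝ _ (mem_generators.2 ?_)))
    have hra : r ≤ |a| := ha.le.trans (le_abs_self a)
    rw [fst_real_smul, snd_real_smul]
    rcases hz with ⟨h1, h2⟩ | ⟨h1, h2⟩
    · exact Or.inr ⟨by rw [h1, smul_zero], norm_inv_smul_le_one (h2.trans hra)⟩
    · exact Or.inl ⟨norm_inv_smul_le_one (h1.trans hra), by rw [h2, smul_zero]⟩
  exact le_of_forall_gt_imp_ge_of_dense key

theorem norm_le_add (z : TwistedSum φ) : ‖z‖ ≤ ‖z.fst‖ + ‖z.snd‖ := by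
  have h : ‖inlHom z.fst + (⟨0, z.snd⟩ : TwistedSum φ)‖ ≤
      ‖(inlHom z.fst : TwistedSum φ)‖ + ‖(⟨0, z.snd⟩ : TwistedSum φ)‖ :=
    gauge_add_le (convex_convexHull ℝ _) absorbent_convexHull_generators _ _
  rw [← eq_add] at h
  exact h.trans (add_le_add
    (norm_le_of_eq_zero_or_eq_zero (norm_nonneg _) (Or.inr ⟨le_rfl, rfl⟩))
    (norm_le_of_eq_zero_or_eq_zero (norm_nonneg _) (Or.inl ⟨rfl, le_rfl⟩)))

theorem normCore : NormedSpace.Core 𝕜 (TwistedSum φ) where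
  norm_nonneg z := gauge_nonneg z
  norm_smul c z := gauge_smul balanced_convexHull_generators c z
  norm_triangle := gauge_add_le (convex_convexHull ℝ _) absorbent_convexHull_generators
  norm_eq_zero_iff z := by
    constructor
    · intro h
      have := norm_components_le z
      rw [h, mul_zero] at this
      exact TwistedSum.ext (norm_le_zero_iff.1 this.1) (norm_le_zero_iff.1 this.2)
    · rintro rfl
      exact gauge_zero

noncomputable instance : NormedAddCommGroup (TwistedSum φ) := NormedAddCommGroup.ofCore normCore

noncomputable instance : NormedSpace 𝕜 (TwistedSum φ) := NormedSpace.ofCore normCore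

theorem _root_.BanachExt.FactorSystem.tendsto_apply (φ : FactorSystem 𝕜 F E) {ι : Type*}
    {l : Filter ι} {f g : ι → F} {x y : F} (hf : Tendsto f l (𝓝 x)) (hg : Tendsto g l (𝓝 y)) :
    Tendsto (fun i => φ (f i) (g i)) l (𝓝 (φ x y)) :=
  (φ.2.continuous.tendsto (x, y)).comp (hf.prodMk_nhds hg)

/-- The first component of `f - z` carries the extra term `φ (f.snd, -z.snd)`, which tends to `φ
(z.snd, -z.snd) = 0` by continuity of `φ`. -/
theorem tendsto_of_tendsto {ι : Type*} {l : Filter ι} {f : ι → TwistedSum φ} {z : TwistedSum φ}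
    (h1 : Tendsto (fun i => (f i).fst) l (𝓝 z.fst))
    (h2 : Tendsto (fun i => (f i).snd) l (𝓝 z.snd)) : Tendsto f l (𝓝 z) := by
  rw [tendsto_iff_norm_sub_tendsto_zero]
  have h3 : Tendsto (fun i => (f i - z).fst) l (𝓝 0) := by
    have := (h1.sub_const z.fst).sub (φ.tendsto_apply h2 (tendsto_const_nhds (x := -z.snd)))
    rw [φ.apply_comm, φ.apply_neg_self, sub_self, sub_zero] at this
    simpa only [sub_eq] using this
  have h4 : Tendsto (fun i => (f i - z).snd) l (𝓝 0) := by
    have := h2.sub_const z.snd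
    rw [sub_self] at this
    simpa only [sub_eq] using this
  refine squeeze_zero (fun _ => norm_nonneg _) (fun i => norm_le_add (f i - z)) ?_
  simpa using h3.norm.add h4.norm

/-- The quotient map of the twisted sum. -/
noncomputable def sndL : TwistedSum φ →L[𝕜] F :=
  LinearMap.mkContinuous ⟨⟨snd, fun _ _ => rfl⟩, fun _ _ => rfl⟩ 1 fun z => by
    rw [one_mul]
    exact (norm_components_le z).2

/-- The embedding into the twisted sum. -/
noncomputable def inlL : E →L[𝕜] TwistedSum φ :=
  LinearMap.mkContinuous ⟨inlHom.toAddHom, fun c x => TwistedSum.ext rfl (smul_zero c).symm⟩ 1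
    fun x => by
      rw [one_mul]
      exact norm_le_of_eq_zero_or_eq_zero (norm_nonneg x) (Or.inr ⟨le_rfl, rfl⟩)

theorem completeSpace [CompleteSpace E] [CompleteSpace F] : CompleteSpace (TwistedSum φ) := by
  refine Metric.complete_of_cauchySeq_tendsto fun f hf => ?_
  obtain ⟨y, hy⟩ := cauchySeq_tendsto_of_complete
    ((sndL (φ := φ)).uniformContinuous.comp_cauchySeq hf)
  replace hy : Tendsto (fun n => (f n).snd) atTop (𝓝 y) := hy
  -- After this shift the second components tend to 0, so the twist in differences `g m - g n`
  -- vanishes in the limit and the first components are Cauchy.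
  let g : ℕ → TwistedSum φ := fun n => f n - ⟨0, y⟩
  have hg2 : Tendsto (fun n => (g n).snd) atTop (𝓝 0) := by
    simpa [g, sub_eq] using hy.sub_const y
  have hdiff : ∀ m n, (g m).fst - (g n).fst = (f m - f n).fst + φ (g m).snd (-(g n).snd) := by
    intro m n
    have : f m - f n = g m - g n := by simp only [g]; abel
    rw [this, sub_eq (g m)]
    exact (sub_add_cancel _ _).symm
  have hg1 : CauchySeq fun n => (g n).fst := by
    rw [Metric.cauchySeq_iff]
    intro ε hε
    have hφ : Tendsto (fun q : ℕ × ℕ => φ (g q.1).snd (-(g q.2).snd)) atTop (𝓝 0) := by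
      have := φ.tendsto_apply (hg2.comp (tendsto_fst (f := atTop (α := ℕ)) (g := atTop (α := ℕ))))
        (hg2.comp (tendsto_snd (f := atTop (α := ℕ)) (g := atTop (α := ℕ)))).neg
      rw [φ.zero_apply, prod_atTop_atTop_eq] at this
      exact this
    obtain ⟨⟨N₁, N₂⟩, hN⟩ := eventually_atTop.1 (Metric.tendsto_nhds.1 hφ (ε / 2) (half_pos hε))
    have hn := norm_nonneg φ
    obtain ⟨N₃, hN₃⟩ := Metric.cauchySeq_iff.1 hf (ε / 2 / (1 + ‖φ‖)) (by positivity)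
    refine ⟨max (max N₁ N₂) N₃, fun m hm n hn' => ?_⟩
    have h1 := hN (m, n) ⟨(le_max_left _ _).trans ((le_max_left _ _).trans hm),
      (le_max_right _ _).trans ((le_max_left _ _).trans hn')⟩
    have h2 := hN₃ m ((le_max_right _ _).trans hm) n ((le_max_right _ _).trans hn')
    rw [dist_zero_right] at h1
    rw [dist_eq_norm, lt_div_iff₀ (by positivity)] at h2
    rw [dist_eq_norm, hdiff]
    have h3 := (norm_components_le (f m - f n)).1
    have h4 := norm_add_le (f m - f n).fst (φ (g m).snd (-(g n).snd))
    linarith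
  obtain ⟨x, hx⟩ := cauchySeq_tendsto_of_complete hg1
  have hg : Tendsto g atTop (𝓝 ⟨x, 0⟩) := tendsto_of_tendsto hx hg2
  refine ⟨⟨x, 0⟩ + ⟨0, y⟩, ?_⟩
  simpa [g] using hg.add_const (⟨0, y⟩ : TwistedSum φ)

variable (φ) in
/-- The twisted sum as an extension. -/
noncomputable def extension [CompleteSpace E] [CompleteSpace F] : Extension 𝕜 F E :=
  have : CompleteSpace (TwistedSum φ) := completeSpace
  { G := TwistedSum φ
    i := inlL
    σ := sndL
    injective := fun _ _ h => congrArg fst h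
    exact := fun z => ⟨fun h => ⟨z.fst, TwistedSum.ext rfl h.symm⟩, by rintro ⟨x, rfl⟩; rfl⟩
    surjective := fun y => ⟨⟨0, y⟩, rfl⟩ }

theorem isTwistedSum_extension [CompleteSpace E] [CompleteSpace F] :
    IsTwistedSum φ (extension φ) (equiv φ) where
  add _ _ := rfl
  smul _ _ := rfl
  i_eq _ := rfl
  σ_eq _ := rfl
  norm_eq _ := rfl

/-- The section is `y ↦ (0, y)`: since `(0, x) + (0, y) = (-φ (x, y), x + y)`, its defect is exactly
`φ`. -/
theorem represents_extension [CompleteSpace E] [CompleteSpace F] :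
    Represents (extension φ) φ := by
  let p : HomogeneousMap 𝕜 F (TwistedSum φ) :=
    ⟨fun y => ⟨0, y⟩,
      continuous_iff_continuousAt.2 fun y => tendsto_of_tendsto tendsto_const_nhds tendsto_id,
      fun c y => TwistedSum.ext (smul_zero c).symm rfl, 1, fun y => by
        simpa using norm_le_add (⟨0, y⟩ : TwistedSum φ)⟩
  refine ⟨p, fun _ => rfl, fun x y => ?_⟩
  change inlHom (φ x y) = (⟨0, x + y⟩ : TwistedSum φ) - ⟨0, x⟩ - ⟨0, y⟩
  rw [sub_sub, eq_sub_iff_add_eq]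
  refine TwistedSum.ext ?_ ?_
  · simp [inlHom, φ.zero_apply]
  · simp [inlHom]

end TwistedSum

end TwistedSumNorm

/-! ### The bijection with the cokernel and its naturality. -/

section Classification

variable {𝕜 : Type v} [RCLike 𝕜] {F E F' E' : Type u}
  [NormedAddCommGroup F] [NormedSpace 𝕜 F] [CompleteSpace F]
  [NormedAddCommGroup E] [NormedSpace 𝕜 E] [CompleteSpace E]
  [NormedAddCommGroup F'] [NormedSpace 𝕜 F'] [CompleteSpace F']
  [NormedAddCommGroup E'] [NormedSpace 𝕜 E'] [CompleteSpace E']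

/-- The class of the factor systems that represent an extension. -/
noncomputable def Ext.toCoker : Ext 𝕜 F E → Coker 𝕜 F E :=
  Quotient.lift
    (fun X => (LinearMap.range (rho 𝕜 F E)).mkQ (Classical.choose X.exists_represents))
    fun X Y h => (Classical.choose_spec X.exists_represents).eq_of_congruent
      (Classical.choose_spec Y.exists_represents) h

/-- Removes the choice: any section computes the class. -/
theorem Represents.toCoker_cls {X : Extension 𝕜 F E} {φ : FactorSystem 𝕜 F E}
    (h : Represents X φ) : X.cls.toCoker = (LinearMap.range (rho 𝕜 F E)).mkQ φ :=
  (Classical.choose_spec X.exists_represents).eq_of_congruent h (congruent_equivalence.refl X)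

theorem Ext.exists_represents (α : Ext 𝕜 F E) :
    ∃ (X : Extension 𝕜 F E) (φ : FactorSystem 𝕜 F E), α = X.cls ∧ Represents X φ := by
  obtain ⟨X, rfl⟩ := Quotient.exists_rep α
  obtain ⟨φ, hφ⟩ := X.exists_represents
  exact ⟨X, φ, rfl, hφ⟩

theorem Ext.toCoker_bijective :
    Function.Bijective (Ext.toCoker : Ext 𝕜 F E → Coker 𝕜 F E) := by
  constructor
  · intro α β h
    obtain ⟨X, φ, rfl, hφ⟩ := α.exists_represents
    obtain ⟨Y, ψ, rfl, hψ⟩ := β.exists_represents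
    rw [hφ.toCoker_cls, hψ.toCoker_cls] at h
    exact Quotient.sound (hφ.congruent_of_eq hψ h)
  · intro c
    obtain ⟨φ, rfl⟩ := Submodule.mkQ_surjective _ c
    exact ⟨_, TwistedSum.represents_extension.toCoker_cls⟩

variable (𝕜 F E) in
/-- The bijection between congruence classes of extensions and classes of factor systems. -/
noncomputable def Ext.equivCoker : Ext 𝕜 F E ≃ Coker 𝕜 F E :=
  Equiv.ofBijective _ Ext.toCoker_bijective

theorem Ext.toCoker_push (T : E →L[𝕜] E') (α : Ext 𝕜 F E) :
    (α.push T).toCoker = Coker.map T (ContinuousLinearMap.id 𝕜 F) α.toCoker := by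
  obtain ⟨X, φ, rfl, hφ⟩ := α.exists_represents
  obtain ⟨ψ, hψ⟩ := (X.push T).exists_represents
  rw [hφ.toCoker_cls]
  -- The map `g ↦ [(g, 0)]` is a morphism over `T` and the identity, since `(i e, 0)` and `(0, T e)`
  -- differ by `(i e, -T e)`.
  refine hψ.toCoker_cls.trans (hφ.map_eq_map hψ T (ContinuousLinearMap.id 𝕜 F)
    ((X.pushGraph T).mkQL ∘L ContinuousLinearMap.inl 𝕜 X.G E') (fun e => ?_) fun g => rfl).symm
  refine (Submodule.Quotient.eq (X.pushGraph T)).2 ((X.mem_pushGraph T _).2 ⟨e, ?_, ?_⟩)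
  · exact (sub_zero _).symm
  · exact (zero_sub _).symm

theorem Ext.toCoker_pull (S : F' →L[𝕜] F) (α : Ext 𝕜 F E) :
    (α.pull S).toCoker = Coker.map (ContinuousLinearMap.id 𝕜 E) S α.toCoker := by
  obtain ⟨X, φ, rfl, hφ⟩ := α.exists_represents
  obtain ⟨ψ, hψ⟩ := (X.pull S).exists_represents
  rw [hφ.toCoker_cls]
  exact hψ.toCoker_cls.trans (hψ.map_eq_map hφ (ContinuousLinearMap.id 𝕜 E) S
    -- The first projection of the pullback is a morphism over the identity and `S`.
    (ContinuousLinearMap.fst 𝕜 X.G F' ∘L (X.pullSpace S).subtypeL) (fun e => rfl)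
    fun g => (X.mem_pullSpace S _).1 g.2)

theorem Ext.toCoker_add (α β : Ext 𝕜 F E) : (α + β).toCoker = α.toCoker + β.toCoker := by
  obtain ⟨X, φ, rfl, hφ⟩ := α.exists_represents
  obtain ⟨Y, ψ, rfl, hψ⟩ := β.exists_represents
  obtain ⟨θ, hθ, hθ'⟩ := hφ.exists_directSum hψ
  have h1 : (X.cls + Y.cls).toCoker = _ := Ext.toCoker_pull
    ((ContinuousLinearMap.id 𝕜 F).prod (ContinuousLinearMap.id 𝕜 F))
    (((X.directSum Y).cls).push (ContinuousLinearMap.fst 𝕜 E E + ContinuousLinearMap.snd 𝕜 E E))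
  rw [h1, Ext.toCoker_push, hθ.toCoker_cls, hφ.toCoker_cls, hψ.toCoker_cls, ← map_add]
  refine congrArg (LinearMap.range (rho 𝕜 F E)).mkQ
    (Subtype.ext (funext fun x => funext fun y => ?_))
  -- On the diagonal, the two components of the factor system of the direct sum are `φ` and `ψ`; the
  -- codiagonal adds them.
  change (θ (x, x) (y, y)).1 + (θ (x, x) (y, y)).2 = φ x y + ψ x y
  rw [hθ']

theorem Ext.toCoker_smul (c : 𝕜) (α : Ext 𝕜 F E) : (c • α).toCoker = c • α.toCoker := by
  obtain ⟨X, φ, rfl, hφ⟩ := α.exists_represents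
  have h1 : (c • X.cls).toCoker = _ :=
    Ext.toCoker_push (c • ContinuousLinearMap.id 𝕜 E) X.cls
  rw [h1, hφ.toCoker_cls, ← map_smul]
  rfl

end Classification

end BanachExt

theorem theorem1 (𝕜 : Type v) [RCLike 𝕜] :
    -- the spaces of factor systems and of homogeneous maps are Banach spaces
    (∀ (F E : Type u) [NormedAddCommGroup F] [NormedSpace 𝕜 F] [CompleteSpace F]
        [NormedAddCommGroup E] [NormedSpace 𝕜 E] [CompleteSpace E],
      CompleteSpace (BanachExt.FactorSystem 𝕜 F E) ∧
        CompleteSpace (BanachExt.HomogeneousMap 𝕜 F E)) ∧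
    -- a family of bijections, for all Banach spaces
    ∃ μ : ∀ (F E : Type u) [NormedAddCommGroup F] [NormedSpace 𝕜 F] [CompleteSpace F]
        [NormedAddCommGroup E] [NormedSpace 𝕜 E] [CompleteSpace E],
        BanachExt.Ext 𝕜 F E ≃ BanachExt.Coker 𝕜 F E,
      -- it is given by Bartle-Graves maps, which exist
      (∀ (F E : Type u) [NormedAddCommGroup F] [NormedSpace 𝕜 F] [CompleteSpace F]
          [NormedAddCommGroup E] [NormedSpace 𝕜 E] [CompleteSpace E]
          (X : BanachExt.Extension 𝕜 F E),
        (∃ p, BanachExt.IsBartleGraves X p) ∧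
        ∀ p, BanachExt.IsBartleGraves X p →
          ∃ φ : BanachExt.FactorSystem 𝕜 F E,
            (∀ x y, X.i (φ x y) = BanachExt.rho 𝕜 F X.G p x y) ∧
            μ F E X.cls = (LinearMap.range (BanachExt.rho 𝕜 F E)).mkQ φ) ∧
      -- the inverse is given by twisted sums
      (∀ (F E : Type u) [NormedAddCommGroup F] [NormedSpace 𝕜 F] [CompleteSpace F]
          [NormedAddCommGroup E] [NormedSpace 𝕜 E] [CompleteSpace E]
          (φ : BanachExt.FactorSystem 𝕜 F E),
        ∃ (X : BanachExt.Extension 𝕜 F E) (e : E × F ≃ X.G),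
          BanachExt.IsTwistedSum φ X e ∧
          (μ F E).symm ((LinearMap.range (BanachExt.rho 𝕜 F E)).mkQ φ) = X.cls) ∧
      -- it is linear
      (∀ (F E : Type u) [NormedAddCommGroup F] [NormedSpace 𝕜 F] [CompleteSpace F]
          [NormedAddCommGroup E] [NormedSpace 𝕜 E] [CompleteSpace E]
          (c : 𝕜) (α β : BanachExt.Ext 𝕜 F E),
        μ F E (α + β) = μ F E α + μ F E β ∧ μ F E (c • α) = c • μ F E α) ∧
      -- it is natural in the second space
      (∀ (F E E' : Type u) [NormedAddCommGroup F] [NormedSpace 𝕜 F] [CompleteSpace F]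
          [NormedAddCommGroup E] [NormedSpace 𝕜 E] [CompleteSpace E]
          [NormedAddCommGroup E'] [NormedSpace 𝕜 E'] [CompleteSpace E']
          (T : E →L[𝕜] E') (α : BanachExt.Ext 𝕜 F E),
        μ F E' (α.push T) =
          BanachExt.Coker.map T (ContinuousLinearMap.id 𝕜 F) (μ F E α)) ∧
      -- it is natural in the first space
      (∀ (F F' E : Type u) [NormedAddCommGroup F] [NormedSpace 𝕜 F] [CompleteSpace F]
          [NormedAddCommGroup F'] [NormedSpace 𝕜 F'] [CompleteSpace F']
          [NormedAddCommGroup E] [NormedSpace 𝕜 E] [CompleteSpace E]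
          (S : F' →L[𝕜] F) (α : BanachExt.Ext 𝕜 F E),
        μ F' E (α.pull S) =
          BanachExt.Coker.map (ContinuousLinearMap.id 𝕜 E) S (μ F E α)) := by
  refine ⟨fun F E _ _ _ _ _ _ =>
    ⟨BanachExt.FactorSystem.completeSpace, BanachExt.HomogeneousMap.completeSpace⟩,
    fun F E _ _ _ _ _ _ => BanachExt.Ext.equivCoker 𝕜 F E,
    fun F E _ _ _ _ _ _ X => ⟨X.exists_isBartleGraves, fun p hp => ?_⟩,
    fun F E _ _ _ _ _ _ φ => ⟨BanachExt.TwistedSum.extension φ, BanachExt.TwistedSum.equiv φ,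
      BanachExt.TwistedSum.isTwistedSum_extension, ?_⟩,
    fun F E _ _ _ _ _ _ c α β => ⟨BanachExt.Ext.toCoker_add α β, BanachExt.Ext.toCoker_smul c α⟩,
    fun F E E' _ _ _ _ _ _ _ _ _ T α => BanachExt.Ext.toCoker_push T α,
    fun F F' E _ _ _ _ _ _ _ _ _ S α => BanachExt.Ext.toCoker_pull S α⟩
  · obtain ⟨φ, hφ⟩ := hp.exists_factorSystem
    exact ⟨φ, hφ, BanachExt.Represents.toCoker_cls ⟨p, hp, hφ⟩⟩
  · rw [Equiv.symm_apply_eq]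
    exact BanachExt.TwistedSum.represents_extension.toCoker_cls.symm
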